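/- Consider a contingency table $\boldsymbol n=(n_1,\dots,n_k)^T$ under Poisson ($c=0$), multinomial ($c=1$) or product-multinomial ($c\ge 2$) sampling. Let $\boldsymbol X_0$ be the $k\times c$ matrix whose columns are the indicators of the $c$ non-empty subtables into which the cells are partitioned (no columns if $c=0$). The cells are independent Poisson variables with means $m_i$, conditioned, if $c\ge 1$, on the subtable totals $\boldsymbol X_0^T\boldsymbol n$ having their prefixed values. A loglinear model with linear constraints (LMLC) is given by a $k\times t$ matrix $\boldsymbol X$ of rank $t$ with $\boldsymbol J_k=(1,\dots,1)^T\in\mathcal C(\boldsymbol X)$ and $\mathcal C(\boldsymbol X_0)\subset\mathcal C(\boldsymbol X)$ (here $\mathcal C$ denotes the column space), a $k\times r$ matrix $\boldsymbol C$ with $\boldsymbol L=(\boldsymbol X_0,\boldsymbol C)$ of rank $c+r\le t$, and a vector $\boldsymbol d^*$. Its parameter space is $\Theta=\{\boldsymbol\theta\in\mathbb R^t:\boldsymbol L^T\boldsymbol m(\boldsymbol\theta)=\boldsymbol d\}$, where $\boldsymbol m(\boldsymbol\theta)=\exp(\boldsymbol X\boldsymbol\theta)$ componentwise and $\boldsymbol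 d$ consists of the prefixed totals followed by $\boldsymbol d^*$; the model is the set $M=\{\boldsymbol m(\boldsymbol\theta):\boldsymbol\theta\in\Theta\}$. A sequence $M_1,\dots,M_B$ of LMLC (with the same $\boldsymbol X_0$) is nested if for each $1\le j<B$ one has $M_{j+1}\subset M_j$, $\mathcal C(\boldsymbol X_{j+1})\subset\mathcal C(\boldsymbol X_j)$, $\mathcal C(\boldsymbol L_j)\subset\mathcal C(\boldsymbol L_{j+1})$, $t_{j+1}\le t_j$ and $r_{j+1}\ge r_j$, at least one of the last two inequalities being strict. Let $\Phi$ be the class of convex functions $\phi:[0,\infty)\to\mathbb R\cup\{\infty\}$, finite and differentiable on $(0,\infty)$, with $\phi(1)=\phi'(1)=0$ and $\phi''(1)>0$. Put $D_\phi(\boldsymbol a,\boldsymbol b)=\sum_i b_i\phi(a_i/b_i)$. The minimum $\phi$-divergence estimator $\widehat{\boldsymbol\theta}_j^{\phi}$ in $M_j$ is a minimizer of $D_\phi(\boldsymbol n,\boldsymbol m(\boldsymbol\theta))$ over $\boldsymbol\theta\in\Theta_j$ (arbitrary for tables for which no minimizer exists). For $\phi_1,\phi_2\in\Phi$ let $$T^{\phi_1}(\widehat{\boldsymbol\theta}_{j+1}^{\phi_2}|\widehat{\boldsymbol\theta}_{j}^{\phi_2})=\frac{2}{\phi_1''(1)}D_{\phi_1}\bigl(\boldsymbol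 m(\widehat{\boldsymbol\theta}_{j}^{\phi_2}),\boldsymbol m(\widehat{\boldsymbol\theta}_{j+1}^{\phi_2})\bigr).$$ **Theorem.** Let $M_1,\dots,M_B$ be a nested sequence of LMLC and $2\le b\le B-1$. Suppose that $M_{b+1}$ holds: the true mean vector is $N\boldsymbol m^*\in M_{b+1}$, where the total mean $N$ tends to infinity, while $\boldsymbol m^*$ (with $\sum_i m_i^*=1$), all $\boldsymbol X_j$, $\boldsymbol C_j$ and $\boldsymbol X_0$ remain fixed; the prefixed totals and the vectors $\boldsymbol d_j^*$ may vary along the sequence, which is nested at each stage. Suppose that the constraints of $M_{b+1}$ are regular at the truth, i.e. $\boldsymbol X_{b+1}^T\operatorname{diag}(\boldsymbol m^*)\boldsymbol L_{b+1}$ has full column rank $c+r_{b+1}$. Then the statistics $T^{\phi_1}(\widehat{\boldsymbol\theta}_{b+1}^{\phi_2}|\widehat{\boldsymbol\theta}_{b}^{\phi_2})$ and $T^{\phi_1}(\widehat{\boldsymbol\theta}_{b}^{\phi_2}|\widehat{\boldsymbol\theta}_{b-1}^{\phi_2})$ are asymptotically independent: as $N\to\infty$ they converge jointly in distribution, and the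 limit law on $\mathbb R^2$ is a product of two probability measures on $\mathbb R$. -/

import Mathlib

open MeasureTheory ProbabilityTheory Filter Topology Matrix

noncomputable section

/-- The class `Φ` of divergence generators `φ : [0, ∞) → ℝ ∪ {∞}`: convex on `[0, ∞)`, finite and
differentiable on `(0, ∞)`, with `φ(1) = φ'(1) = 0` and `φ''(1) > 0`.  The values of the
total function `φ` at negative reals are never used.  (Since `deriv` is `0` at a point of
non-differentiability, `second_deriv_one` contains the existence of `φ''(1)`.) -/
structure IsDivergenceGenerator (φ : ℝ → EReal) : Prop where
  zero_ne_bot : φ 0 ≠ ⊥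
  finite : ∀ x : ℝ, 0 < x → φ x ≠ ⊤ ∧ φ x ≠ ⊥
  convex : ∀ x y a b : ℝ, 0 ≤ x → 0 ≤ y → 0 ≤ a → 0 ≤ b → a + b = 1 →
    φ (a * x + b * y) ≤ (a : EReal) * φ x + (b : EReal) * φ y
  differentiable : DifferentiableOn ℝ (fun x => (φ x).toReal) (Set.Ioi 0)
  map_one : φ 1 = 0
  deriv_one : deriv (fun x => (φ x).toReal) 1 = 0
  second_deriv_one : 0 < deriv (deriv (fun x => (φ x).toReal)) 1

/-- The number `φ''(1)`. -/
def secondDerivOne (φ : ℝ → EReal) : ℝ := deriv (deriv (fun x => (φ x).toReal)) 1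

/-- The summand `b φ(a / b)` of a `φ`-divergence, with the conventions `0 φ(0 / 0) = 0` and
`0 φ(p / 0) = p lim_{u → ∞} φ(u) / u`. -/
def divergenceTerm (φ : ℝ → EReal) (a b : ℝ) : EReal :=
  if b = 0 then
    if a = 0 then 0 else (a : EReal) * limUnder atTop (fun u : ℝ => φ u / (u : EReal))
  else (b : EReal) * φ (a / b)

/-- The `φ`-divergence `D_φ(a, b) = ∑ b_i φ(a_i / b_i)` between two non-negative vectors. -/
def phiDivergence {k : ℕ} (φ : ℝ → EReal) (a b : Fin k → ℝ) : EReal :=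
  ∑ i, divergenceTerm φ (a i) (b i)

/-- `X₀` is the `k × c` matrix of a sampling plan.  For `c = 0` (Poisson sampling) it has no columns;
for `c ≥ 1` (multinomial or product-multinomial sampling) the cells are partitioned into `c` non-empty
subtables, cell `i` lying in the subtable `s i`, and the `h`-th column is the indicator of the
`h`-th subtable. -/
def IsSamplingMatrix {k c : ℕ} (X₀ : Matrix (Fin k) (Fin c) ℝ) : Prop :=
  c = 0 ∨ ∃ s : Fin k → Fin c, Function.Surjective s ∧
    X₀ = Matrix.of fun i h => if s i = h then 1 else 0

/-- The law of the table `n` when its mean vector is `m`: the cells are independent Poisson variables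
with means `m i`, conditioned on the event `X₀ᵀ n = tot` that the subtable totals take their
prefixed values.  For `c = 0` the event is certain and this is the product of Poisson laws;
for `c ≥ 1` it is the (product-)multinomial law. -/
def samplingLaw {k c : ℕ} (X₀ : Matrix (Fin k) (Fin c) ℝ) (tot : Fin c → ℕ) (m : Fin k → ℝ) :
    Measure (Fin k → ℕ) :=
  ProbabilityTheory.cond (Measure.pi fun i => poissonMeasure (m i).toNNReal)
    {n | X₀ᵀ *ᵥ (fun i => (n i : ℝ)) = fun h => (tot h : ℝ)}

/-- A loglinear model with linear constraints on a table with `k` cells: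
`log m(θ) = X θ` and `Cᵀ m(θ) = d*`, where the right-hand side `d* = dstar ν` may depend on the
stage `ν` of the asymptotic sequence. -/
structure LMLC (k : ℕ) where
  t : ℕ
  r : ℕ
  X : Matrix (Fin k) (Fin t) ℝ
  C : Matrix (Fin k) (Fin r) ℝ
  dstar : ℕ → Fin r → ℝ

namespace LMLC

variable {k c : ℕ}

/-- The mean vector `m(θ) = exp (X θ)`. -/
def mean (M : LMLC k) (θ : Fin M.t → ℝ) : Fin k → ℝ :=
  fun i => Real.exp ((M.X *ᵥ θ) i)

/-- The matrix `L = (X₀, C)` of all the linear constraints. -/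
def L (M : LMLC k) (X₀ : Matrix (Fin k) (Fin c) ℝ) : Matrix (Fin k) (Fin c ⊕ Fin M.r) ℝ :=
  Matrix.fromCols X₀ M.C

/-- The right-hand side `d` of the constraints: prefixed totals, followed by `d*`. -/
def d (M : LMLC k) (tot : Fin c → ℕ) (ν : ℕ) : Fin c ⊕ Fin M.r → ℝ :=
  Sum.elim (fun h => (tot h : ℝ)) (M.dstar ν)

/-- The parameter space `Θ = {θ : Lᵀ m(θ) = d}`. -/
def paramSpace (M : LMLC k) (X₀ : Matrix (Fin k) (Fin c) ℝ) (tot : Fin c → ℕ) (ν : ℕ) :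
    Set (Fin M.t → ℝ) :=
  {θ | (M.L X₀)ᵀ *ᵥ M.mean θ = M.d tot ν}

/-- The model as a set of mean vectors, `{m(θ) : θ ∈ Θ}`. -/
def model (M : LMLC k) (X₀ : Matrix (Fin k) (Fin c) ℝ) (tot : Fin c → ℕ) (ν : ℕ) :
    Set (Fin k → ℝ) :=
  M.mean '' M.paramSpace X₀ tot ν

/-- Standing requirements on a loglinear model with linear constraints. -/
structure IsAdmissible (M : LMLC k) (X₀ : Matrix (Fin k) (Fin c) ℝ) : Prop where
  rank_X : M.X.rank = M.t
  one_mem : (1 : Fin k → ℝ) ∈ Submodule.span ℝ (Set.range M.X.col)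
  span_X₀_le : Submodule.span ℝ (Set.range X₀.col) ≤ Submodule.span ℝ (Set.range M.X.col)
  constraints_le : c + M.r ≤ M.t
  rank_L : (M.L X₀).rank = c + M.r

/-- `M'` is nested within `M`. -/
structure NestedIn (M' M : LMLC k) (X₀ : Matrix (Fin k) (Fin c) ℝ) (tot : ℕ → Fin c → ℕ) :
    Prop where
  model_subset : ∀ ν, M'.model X₀ (tot ν) ν ⊆ M.model X₀ (tot ν) ν
  span_X_le : Submodule.span ℝ (Set.range M'.X.col) ≤ Submodule.span ℝ (Set.range M.X.col)
  span_L_le :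
    Submodule.span ℝ (Set.range (M.L X₀).col) ≤ Submodule.span ℝ (Set.range (M'.L X₀).col)
  t_le : M'.t ≤ M.t
  r_le : M.r ≤ M'.r
  strict : M'.t < M.t ∨ M.r < M'.r

/-- `θ` minimizes `D_φ(n, m(θ))` over the parameter space. -/
def IsMinimizer (M : LMLC k) (X₀ : Matrix (Fin k) (Fin c) ℝ) (tot : Fin c → ℕ) (ν : ℕ)
    (φ : ℝ → EReal) (n : Fin k → ℕ) (θ : Fin M.t → ℝ) : Prop :=
  θ ∈ M.paramSpace X₀ tot ν ∧
    ∀ θ' ∈ M.paramSpace X₀ tot ν,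
      phiDivergence φ (fun i => (n i : ℝ)) (M.mean θ) ≤
        phiDivergence φ (fun i => (n i : ℝ)) (M.mean θ')

/-- `est` is a minimum `φ`-divergence estimator: for every table `n` for which the minimum of
`D_φ(n, m(θ))` over the parameter space is attained, `est n` is a point at which it is attained
(for other tables `est n` is arbitrary). -/
def IsMinDivEstimator (M : LMLC k) (X₀ : Matrix (Fin k) (Fin c) ℝ) (tot : Fin c → ℕ) (ν : ℕ)
    (φ : ℝ → EReal) (est : (Fin k → ℕ) → Fin M.t → ℝ) : Prop :=
  ∀ n, (∃ θ, M.IsMinimizer X₀ tot ν φ n θ) → M.IsMinimizer X₀ tot ν φ n (est n)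

/-- The test statistic `T^φ(θ' | θ) = (2 / φ''(1)) D_φ(m(θ), m(θ'))` for testing the model `M'` (with
parameter `θ'`) against `M` (with parameter `θ`).  The divergence is finite, as both mean vectors
have positive components. -/
def testStat (M' M : LMLC k) (φ : ℝ → EReal) (θ' : Fin M'.t → ℝ) (θ : Fin M.t → ℝ) : ℝ :=
  2 / secondDerivOne φ * (phiDivergence φ (M.mean θ) (M'.mean θ')).toReal

end LMLC

/-- Two sequences of real random variables, `S ν` and `T ν` on `(Ω ν, P ν)`, are asymptotically
independent: `(S ν, T ν)` converges jointly in distribution and the limit law is a product. -/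
def AsymptoticallyIndependent {Ω : ℕ → Type*} [∀ ν, MeasurableSpace (Ω ν)]
    (P : ∀ ν, Measure (Ω ν)) [∀ ν, IsProbabilityMeasure (P ν)] (S T : ∀ ν, Ω ν → ℝ) : Prop :=
  ∃ (μ₁ μ₂ : Measure ℝ) (_ : IsProbabilityMeasure μ₁) (_ : IsProbabilityMeasure μ₂),
    TendstoInDistribution (fun ν ω => (S ν ω, T ν ω)) atTop (id : ℝ × ℝ → ℝ × ℝ) P (μ₁.prod μ₂)

end

/-! Rescale by the total mean: `p = n / N` is compared with the fixed vector `m`, and the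
standardized table `w`, with coordinates `(n i - N m i) / √(N m i)`, is `√N` times the standardized
`p`. In these coordinates each model is, near `m`, a manifold with a tangent space `T`, and every
`φ`-divergence is, to second order, `φ''(1) / 2` times the squared Euclidean distance
(`isLittleO_realDivergence`). Hence a minimum divergence estimate is, to first order, the orthogonal
projection of the data to `T`, whatever the generator (`isLittleO_standardize_minimizer`). Each
statistic is therefore `‖(P - P') w‖ ^ 2` up to an error that vanishes uniformly on bounded sets of
`w`, where `P` and `P'` project to the tangent spaces of the larger and of the smaller model
(`eventually_abs_testStat_sub_le`).

Nested models have nested tangent spaces, so the two differences of projections have product zero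
(`starProjection_sub_comp_eq_zero`). The prefixed totals confine `w` to a subspace that contains all
these tangent spaces, and `w` converges in law to the projection of a standard Gaussian vector to it
(`tendsto_charFun_samplingLaw`). The differences of projections do not see that extra projection,
and symmetric operators with product zero send a standard Gaussian vector to independent vectors
(`map_prodMk_stdGaussian`). Tightness and continuous mapping carry this over to the statistics
(`asymptoticallyIndependent_of_approx`).

The local estimates hold along arbitrary filters. Applied to the filter of all data points near `m`
paired with minimizers, they become uniform in the choice of minimizer, so uniqueness of the
estimate is never needed. -/

noncomputable section

open Asymptotics Set

/-! ### Divergence generators and their quadratic behaviour at 1 -/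

/-- The real-valued restriction of a divergence generator. -/
def realGenerator (φ : ℝ → EReal) (x : ℝ) : ℝ := (φ x).toReal

/-- The `φ`-divergence between two vectors with positive entries. -/
def realDivergence {k : ℕ} (φ : ℝ → EReal) (a b : Fin k → ℝ) : ℝ :=
  ∑ i, b i * realGenerator φ (a i / b i)

/-- The coordinates `(u i - m i) / √(m i)` of a vector `u`. -/
def standardize {k : ℕ} (m u : Fin k → ℝ) : EuclideanSpace ℝ (Fin k) :=
  WithLp.toLp 2 fun i => (u i - m i) / √(m i)

namespace IsDivergenceGenerator

variable {φ : ℝ → EReal}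

theorem coe_realGenerator (hφ : IsDivergenceGenerator φ) {x : ℝ} (hx : 0 < x) :
    ((realGenerator φ x : ℝ) : EReal) = φ x :=
  EReal.coe_toReal (hφ.finite x hx).1 (hφ.finite x hx).2

theorem convexOn (hφ : IsDivergenceGenerator φ) : ConvexOn ℝ (Ioi 0) (realGenerator φ) := by
  refine ⟨convex_Ioi 0, fun x hx y hy a b ha hb hab => ?_⟩
  have hx' : (0 : ℝ) < x := hx
  have hy' : (0 : ℝ) < y := hy
  have hxy : a • x + b • y ∈ Ioi (0 : ℝ) := convex_Ioi 0 hx hy ha hb hab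
  have h := hφ.convex x y a b hx'.le hy'.le ha hb hab
  rw [← hφ.coe_realGenerator hx', ← hφ.coe_realGenerator hy',
    ← hφ.coe_realGenerator (by simpa using hxy)] at h
  simpa using (by exact_mod_cast h :
    realGenerator φ (a * x + b * y) ≤ a * realGenerator φ x + b * realGenerator φ y)

theorem realGenerator_one (hφ : IsDivergenceGenerator φ) : realGenerator φ 1 = 0 := by
  simp [realGenerator, hφ.map_one]

theorem differentiableAt (hφ : IsDivergenceGenerator φ) {x : ℝ} (hx : 0 < x) :
    DifferentiableAt ℝ (realGenerator φ) x :=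
  (hφ.differentiable x hx).differentiableAt (Ioi_mem_nhds hx)

theorem hasDerivAt_one (hφ : IsDivergenceGenerator φ) : HasDerivAt (realGenerator φ) 0 1 := by
  have h := (hφ.differentiableAt one_pos).hasDerivAt
  rwa [show deriv (realGenerator φ) 1 = 0 from hφ.deriv_one] at h

theorem secondDerivOne_pos (hφ : IsDivergenceGenerator φ) : 0 < secondDerivOne φ :=
  hφ.second_deriv_one

theorem hasDerivAt_deriv_one (hφ : IsDivergenceGenerator φ) :
    HasDerivAt (deriv (realGenerator φ)) (secondDerivOne φ) 1 :=
  (differentiableAt_of_deriv_ne_zero hφ.second_deriv_one.ne').hasDerivAt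

/-- The tangent line at 1 is the zero function, and a convex function lies above its tangents. -/
theorem realGenerator_nonneg (hφ : IsDivergenceGenerator φ) {x : ℝ} (hx : 0 < x) :
    0 ≤ realGenerator φ x := by
  have h1 : (1 : ℝ) ∈ Ioi (0 : ℝ) := mem_Ioi.2 one_pos
  rcases lt_trichotomy x 1 with h | h | h
  · have := hφ.convexOn.slope_le_of_hasDerivAt hx h1 h hφ.hasDerivAt_one
    rw [slope_def_field, hφ.realGenerator_one, div_le_iff₀ (by linarith)] at this
    linarith
  · rw [h, hφ.realGenerator_one]
  · have := hφ.convexOn.le_slope_of_hasDerivAt h1 hx h hφ.hasDerivAt_one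
    rw [slope_def_field, hφ.realGenerator_one, le_div_iff₀ (by linarith)] at this
    linarith

/-- Second order expansion of a divergence generator at `1`. -/
theorem isLittleO_realGenerator (hφ : IsDivergenceGenerator φ) :
    (fun x => realGenerator φ x - secondDerivOne φ / 2 * (x - 1) ^ 2) =o[𝓝 1]
      fun x => (x - 1) ^ 2 := by
  set κ := secondDerivOne φ
  rw [isLittleO_iff]
  intro ε hε
  have hd := hφ.hasDerivAt_deriv_one.isLittleO
  have hd1 : deriv (realGenerator φ) 1 = 0 := hφ.deriv_one
  have hev := (isLittleO_iff.1 hd hε).and (Ioi_mem_nhds (one_pos (α := ℝ)))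
  obtain ⟨ρ, hρ, hball⟩ := Metric.eventually_nhds_iff_ball.1 hev
  filter_upwards [Metric.ball_mem_nhds (1 : ℝ) hρ] with x hx
  -- The second derivative is only known to exist at 1, so the remainder is bounded by the mean
  -- value inequality on the segment from 1 to `x`, using the first order expansion of `φ'` at 1.
  have hder : ∀ y ∈ uIcc 1 x, HasDerivWithinAt
      (fun x => realGenerator φ x - κ / 2 * (x - 1) ^ 2)
      (deriv (realGenerator φ) y - κ * (y - 1)) (uIcc 1 x) y := by
    intro y hy
    have hyb : y ∈ Metric.ball (1 : ℝ) ρ :=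
      (convex_ball (1 : ℝ) ρ).ordConnected.uIcc_subset (Metric.mem_ball_self hρ) hx hy
    have h1 := (hφ.differentiableAt (hball y hyb).2).hasDerivAt
    have h2 : HasDerivAt (fun x : ℝ => κ / 2 * (x - 1) ^ 2) (κ * (y - 1)) y := by
      have := (((hasDerivAt_id y).sub_const 1).pow 2).const_mul (κ / 2)
      refine this.congr_deriv ?_
      simp
      ring
    exact (h1.sub h2).hasDerivWithinAt
  have hbound : ∀ y ∈ uIcc 1 x, ‖deriv (realGenerator φ) y - κ * (y - 1)‖ ≤ ε * |x - 1| := by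
    intro y hy
    have hyb : y ∈ Metric.ball (1 : ℝ) ρ :=
      (convex_ball (1 : ℝ) ρ).ordConnected.uIcc_subset (Metric.mem_ball_self hρ) hx hy
    have h1 := (hball y hyb).1
    simp only [hd1, sub_zero, smul_eq_mul] at h1
    rw [mul_comm κ]
    refine h1.trans ?_
    gcongr
    simpa [Real.norm_eq_abs] using Set.abs_sub_left_of_mem_uIcc hy
  have := Convex.norm_image_sub_le_of_norm_hasDerivWithin_le hder hbound (convex_uIcc 1 x)
    left_mem_uIcc right_mem_uIcc
  simp only [hφ.realGenerator_one, sub_self, ne_eq, OfNat.ofNat_ne_zero, not_false_eq_true,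
    zero_pow, mul_zero, sub_zero] at this
  refine this.trans (le_of_eq ?_)
  rw [Real.norm_eq_abs, Real.norm_eq_abs, abs_pow]
  ring

/-- With relative error `φ''(1) / 4`, the quadratic expansion leaves at least `φ''(1) / 4 * (y - 1)
^ 2` near 1. The points `1 - r` and `1 + r` anchor the linear lower bound away from 1. -/
theorem exists_pos_nearby (hφ : IsDivergenceGenerator φ) {ρ : ℝ} (hρ : 0 < ρ) :
    ∃ r, 0 < r ∧ r ≤ ρ ∧ r < 1 ∧ 0 < realGenerator φ (1 - r) ∧ 0 < realGenerator φ (1 + r) := by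
  have hκ := hφ.secondDerivOne_pos
  have h := isLittleO_iff.1 hφ.isLittleO_realGenerator (c := secondDerivOne φ / 4) (by positivity)
  obtain ⟨δ, hδ, hball⟩ := Metric.eventually_nhds_iff_ball.1 h
  have key : ∀ y ∈ Metric.ball (1 : ℝ) δ, y ≠ 1 → 0 < realGenerator φ y := by
    intro y hy hne
    have h1 := hball y hy
    have h2 : 0 < (y - 1) ^ 2 := by have := sub_ne_zero.2 hne; positivity
    rw [Real.norm_eq_abs, Real.norm_eq_abs, abs_of_pos h2] at h1
    have := (abs_le.1 h1).1
    nlinarith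
  set r := min ρ (min (δ / 2) (1 / 2))
  have hr : 0 < r := by positivity
  have hr1 : r ≤ ρ := min_le_left _ _
  have hr2 : r ≤ δ / 2 := (min_le_right _ _).trans (min_le_left _ _)
  have hr3 : r ≤ 1 / 2 := (min_le_right _ _).trans (min_le_right _ _)
  refine ⟨r, hr, hr1, by linarith, key _ ?_ (by linarith), key _ ?_ (by linarith)⟩
  · rw [Metric.mem_ball, Real.dist_eq, abs_lt]
    constructor <;> linarith
  · rw [Metric.mem_ball, Real.dist_eq, abs_lt]
    constructor <;> linarith

/-- Away from `1`, a divergence generator grows at least linearly. -/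
theorem exists_linear_lower_bound (hφ : IsDivergenceGenerator φ) {ρ : ℝ} (hρ : 0 < ρ) :
    ∃ c, 0 < c ∧ ∀ x, 0 < x → ρ ≤ |x - 1| → c * |x - 1| ≤ realGenerator φ x := by
  obtain ⟨r, hr, hrρ, hr1, hm, hp⟩ := hφ.exists_pos_nearby hρ
  have h1 : (1 : ℝ) ∈ Ioi (0 : ℝ) := mem_Ioi.2 one_pos
  refine ⟨min (realGenerator φ (1 - r) / r) (realGenerator φ (1 + r) / r), by positivity, ?_⟩
  intro x hx hxρ
  -- Secant slopes through 1 are monotone, so the slope at `x` is compared with the slope at `1 + r`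
  -- or at `1 - r`.
  rcases le_total 1 x with h | h
  · rw [abs_of_nonneg (by linarith)] at hxρ ⊢
    have := hφ.convexOn.secant_mono h1 (x := 1 + r) (y := x) (mem_Ioi.2 (by linarith)) hx
      (by linarith) (by linarith) (by linarith)
    rw [hφ.realGenerator_one, le_div_iff₀ (by linarith)] at this
    simp only [sub_zero, add_sub_cancel_left] at this
    exact (mul_le_mul_of_nonneg_right (min_le_right _ _) (by linarith)).trans this
  · rw [abs_of_nonpos (by linarith)] at hxρ ⊢
    have := hφ.convexOn.secant_mono h1 (x := x) (y := 1 - r) hx (mem_Ioi.2 (by linarith))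
      (by linarith) (by linarith) (by linarith)
    rw [hφ.realGenerator_one, div_le_iff_of_neg (by linarith)] at this
    simp only [sub_zero, sub_sub_cancel_left, div_neg] at this
    refine le_trans (mul_le_mul_of_nonneg_right (min_le_left _ _) (by linarith)) ?_
    linarith

/-- If `b φ(a / b) → 0` and `a` converges to a positive limit, then `b` has the same limit. -/
theorem tendsto_of_term_tendsto_zero (hφ : IsDivergenceGenerator φ) {α : Type*} {l : Filter α}
    {a b : α → ℝ} {m : ℝ} (hm : 0 < m) (ha : Tendsto a l (𝓝 m)) (hb : ∀ᶠ x in l, 0 < b x)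
    (h : Tendsto (fun x => b x * realGenerator φ (a x / b x)) l (𝓝 0)) :
    Tendsto b l (𝓝 m) := by
  have hab : Tendsto (fun x => a x - b x) l (𝓝 0) := by
    rw [Metric.tendsto_nhds]
    intro ε hε
    -- If `a / b` is within `ρ ≤ 1 / 2` of 1, then `b < 2 a < 4 m`, and `ρ * 8 m ≤ ε` gives `|a - b|
    -- < b ρ < ε`. Otherwise the linear lower bound turns smallness of `b φ(a / b)` into smallness
    -- of `|a - b|`.
    set ρ := min (1 / 2) (ε / (8 * m))
    have hρ : 0 < ρ := by positivity
    have hρ1 : ρ ≤ 1 / 2 := min_le_left _ _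
    have hρ2 : ρ * (8 * m) ≤ ε := by
      rw [← le_div_iff₀ (by positivity)]; exact min_le_right _ _
    obtain ⟨c, hc, hlin⟩ := hφ.exists_linear_lower_bound hρ
    have h1 : ∀ᶠ x in l, a x < 2 * m := ha.eventually_lt_const (by linarith)
    have h2 : ∀ᶠ x in l, 0 < a x := ha.eventually_const_lt hm
    have h3 : ∀ᶠ x in l, b x * realGenerator φ (a x / b x) < c * ε :=
      h.eventually_lt_const (by positivity)
    filter_upwards [h1, h2, h3, hb] with x h1 h2 h3 hb
    rw [Real.dist_eq, sub_zero]
    have hmul : b x * |a x / b x - 1| = |a x - b x| := by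
      rw [← abs_of_pos hb, ← abs_mul, abs_of_pos hb]
      congr 1
      field_simp
    rcases le_or_gt ρ |a x / b x - 1| with hx | hx
    · have := hlin _ (div_pos h2 hb) hx
      have h4 : c * |a x - b x| ≤ b x * realGenerator φ (a x / b x) := by
        rw [← hmul]; nlinarith
      exact lt_of_mul_lt_mul_left (h4.trans_lt h3) hc.le
    · have h5 : |a x - b x| < b x * ρ := by rw [← hmul]; gcongr
      have h6 := (abs_lt.1 h5).1
      have h7 : b x < 4 * m := by nlinarith
      nlinarith
  simpa using ha.sub hab

variable {k : ℕ}

theorem phiDivergence_eq (hφ : IsDivergenceGenerator φ) {a b : Fin k → ℝ} (ha : ∀ i, 0 < a i)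
    (hb : ∀ i, 0 < b i) : phiDivergence φ a b = ((realDivergence φ a b : ℝ) : EReal) := by
  have h : ∀ i, divergenceTerm φ (a i) (b i) =
      ((b i * realGenerator φ (a i / b i) : ℝ) : EReal) := by
    intro i
    rw [divergenceTerm, if_neg (hb i).ne', EReal.coe_mul,
      hφ.coe_realGenerator (div_pos (ha i) (hb i))]
  unfold phiDivergence realDivergence
  rw [Finset.sum_congr rfl fun i _ => h i]
  exact (map_sum (⟨⟨Real.toEReal, rfl⟩, fun _ _ => rfl⟩ : ℝ →+ EReal) _ _).symm

theorem realDivergence_nonneg (hφ : IsDivergenceGenerator φ) {a b : Fin k → ℝ} (ha : ∀ i, 0 < a i)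
    (hb : ∀ i, 0 < b i) : 0 ≤ realDivergence φ a b :=
  Finset.sum_nonneg fun i _ =>
    mul_nonneg (hb i).le (hφ.realGenerator_nonneg (div_pos (ha i) (hb i)))

/-- All summands are non-negative, so each one is squeezed between zero and the whole divergence. -/
theorem tendsto_of_realDivergence (hφ : IsDivergenceGenerator φ) {α : Type*} {l : Filter α}
    {a b : α → Fin k → ℝ} {m : Fin k → ℝ} (hm : ∀ i, 0 < m i) (ha : Tendsto a l (𝓝 m))
    (hb : ∀ᶠ x in l, ∀ i, 0 < b x i)
    (h : Tendsto (fun x => realDivergence φ (a x) (b x)) l (𝓝 0)) : Tendsto b l (𝓝 m) := by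
  rw [tendsto_pi_nhds] at ha ⊢
  intro i
  have hap : ∀ᶠ x in l, ∀ i, 0 < a x i :=
    eventually_all.2 fun i => (ha i).eventually_const_lt (hm i)
  refine hφ.tendsto_of_term_tendsto_zero (hm i) (ha i) (hb.mono fun x hx => hx i) ?_
  refine tendsto_of_tendsto_of_tendsto_of_le_of_le' tendsto_const_nhds h ?_ ?_
  · filter_upwards [hap, hb] with x hax hbx
    exact mul_nonneg (hbx i).le (hφ.realGenerator_nonneg (div_pos (hax i) (hbx i)))
  · filter_upwards [hap, hb] with x hax hbx
    exact Finset.single_le_sum (f := fun i => b x i * realGenerator φ (a x i / b x i))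
      (fun j _ => mul_nonneg (hbx j).le (hφ.realGenerator_nonneg (div_pos (hax j) (hbx j))))
      (Finset.mem_univ i)

/-- Expanding `φ` at `a / b → 1` gives the main term with weight `1 / b`. Replacing it by the fixed
weight `1 / m` costs a factor tending to zero. -/
theorem isLittleO_term (hφ : IsDivergenceGenerator φ) {α : Type*} {l : Filter α}
    {a b : α → ℝ} {m : ℝ} (hm : 0 < m) (ha : Tendsto a l (𝓝 m)) (hb : Tendsto b l (𝓝 m)) :
    (fun x => b x * realGenerator φ (a x / b x) -
      secondDerivOne φ / 2 * ((a x - b x) ^ 2 / m)) =o[l] fun x => (a x - b x) ^ 2 := by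
  have hratio : Tendsto (fun x => a x / b x) l (𝓝 1) := by
    have := ha.div hb hm.ne'
    rwa [div_self hm.ne'] at this
  have hbinv : Tendsto (fun x => (b x)⁻¹) l (𝓝 m⁻¹) := hb.inv₀ hm.ne'
  have hbpos : ∀ᶠ x in l, 0 < b x := hb.eventually_const_lt hm
  have h1 := hφ.isLittleO_realGenerator.comp_tendsto hratio
  have h2 : (fun x => b x * (realGenerator φ (a x / b x) -
      secondDerivOne φ / 2 * (a x / b x - 1) ^ 2)) =o[l]
      fun x => b x * (a x / b x - 1) ^ 2 := (isBigO_refl b l).mul_isLittleO h1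
  have h3 : (fun x => b x * (a x / b x - 1) ^ 2) =O[l] fun x => (a x - b x) ^ 2 := by
    have : (fun x => b x * (a x / b x - 1) ^ 2) =ᶠ[l] fun x => (b x)⁻¹ * (a x - b x) ^ 2 := by
      filter_upwards [hbpos] with x hx
      field_simp
    refine this.trans_isBigO ?_
    simpa using (hbinv.isBigO_one ℝ).mul (isBigO_refl (fun x => (a x - b x) ^ 2) l)
  have h4 : (fun x => secondDerivOne φ / 2 * (((b x)⁻¹ - m⁻¹) * (a x - b x) ^ 2)) =o[l]
      fun x => (a x - b x) ^ 2 := by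
    refine IsLittleO.const_mul_left ?_ _
    have : (fun x => (b x)⁻¹ - m⁻¹) =o[l] fun _ => (1 : ℝ) := by
      rw [isLittleO_one_iff]
      simpa using hbinv.sub_const m⁻¹
    simpa using this.mul_isBigO (isBigO_refl (fun x => (a x - b x) ^ 2) l)
  refine ((h2.trans_isBigO h3).add h4).congr' ?_ EventuallyEq.rfl
  filter_upwards [hbpos] with x hx
  field_simp
  ring

/-- Near a vector `m` with positive entries, a `φ`-divergence is the square of a Euclidean
distance up to a smaller order term. -/
theorem isLittleO_realDivergence (hφ : IsDivergenceGenerator φ) {α : Type*} {l : Filter α}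
    {a b : α → Fin k → ℝ} {m : Fin k → ℝ} (hm : ∀ i, 0 < m i) (ha : Tendsto a l (𝓝 m))
    (hb : Tendsto b l (𝓝 m)) :
    (fun x => realDivergence φ (a x) (b x) -
      secondDerivOne φ / 2 * ‖standardize m (a x) - standardize m (b x)‖ ^ 2) =o[l]
      fun x => ‖standardize m (a x) - standardize m (b x)‖ ^ 2 := by
  rw [tendsto_pi_nhds] at ha hb
  have hnorm : ∀ x, ‖standardize m (a x) - standardize m (b x)‖ ^ 2 =
      ∑ i, (a x i - b x i) ^ 2 / m i := by
    intro x
    rw [EuclideanSpace.norm_sq_eq]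
    refine Finset.sum_congr rfl fun i _ => ?_
    simp only [standardize, PiLp.sub_apply, Real.norm_eq_abs, sq_abs]
    rw [← sub_div, div_pow, Real.sq_sqrt (hm i).le]
    ring
  have hterm : ∀ i, (fun x => b x i * realGenerator φ (a x i / b x i) -
      secondDerivOne φ / 2 * ((a x i - b x i) ^ 2 / m i)) =o[l]
      fun x => ‖standardize m (a x) - standardize m (b x)‖ ^ 2 := by
    intro i
    refine (hφ.isLittleO_term (hm i) (ha i) (hb i)).trans_isBigO ?_
    refine IsBigO.of_bound (m i) (Eventually.of_forall fun x => ?_)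
    rw [hnorm, Real.norm_of_nonneg (sq_nonneg _), Real.norm_of_nonneg
      (Finset.sum_nonneg fun i _ => div_nonneg (sq_nonneg _) (hm i).le)]
    rw [← div_le_iff₀' (hm i)]
    exact Finset.single_le_sum (f := fun i => (a x i - b x i) ^ 2 / m i)
      (fun j _ => div_nonneg (sq_nonneg _) (hm j).le) (Finset.mem_univ i)
  refine (IsLittleO.sum fun i (_ : i ∈ Finset.univ) => hterm i).congr' ?_ EventuallyEq.rfl
  refine Eventually.of_forall fun x => ?_
  simp only [realDivergence, hnorm, Finset.sum_apply, Finset.sum_sub_distrib, Finset.mul_sum]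

end IsDivergenceGenerator

/-- Homogeneity of degree one lets tables and means be divided by the total `N` without changing the
minimizers. -/
theorem realDivergence_smul {k : ℕ} (φ : ℝ → EReal) {N : ℝ} (hN : N ≠ 0) (a b : Fin k → ℝ) :
    realDivergence φ (N • a) (N • b) = N * realDivergence φ a b := by
  simp only [realDivergence, Finset.mul_sum, Pi.smul_apply, smul_eq_mul]
  refine Finset.sum_congr rfl fun i _ => ?_
  rw [mul_div_mul_left _ _ hN, mul_assoc]

theorem continuous_standardize {k : ℕ} (m : Fin k → ℝ) : Continuous (standardize m) := by
  unfold standardize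
  fun_prop

theorem standardize_self {k : ℕ} (m : Fin k → ℝ) : standardize m m = 0 := by
  ext i
  simp [standardize]

end

/-! ### Constraint sets and their tangent spaces -/

noncomputable section

open Asymptotics Set

section Constraint

variable {k : ℕ} {κ : Type*}

/-- The mean vectors `x` with positive entries satisfying the constraints `Lᵀ x = Lᵀ m` of the
model with `log x ∈ log m + V`. -/
def feasibleSet (m : Fin k → ℝ) (V : Submodule ℝ (Fin k → ℝ)) (L : Matrix (Fin k) κ ℝ) :
    Set (Fin k → ℝ) :=
  {x | (∀ i, 0 < x i) ∧ (fun i => Real.log (x i / m i)) ∈ V ∧ Lᵀ *ᵥ x = Lᵀ *ᵥ m}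

/-- The map sending `ξ` to the vector with coordinates `√(m i) ξ i`. -/
def sqrtScale (m : Fin k → ℝ) : (Fin k → ℝ) →ₗ[ℝ] EuclideanSpace ℝ (Fin k) :=
  (WithLp.linearEquiv 2 ℝ (Fin k → ℝ)).symm.toLinearMap ∘ₗ
    (Matrix.diagonal fun i => √(m i)).mulVecLin

/-- The derivative of the constraints in standardized coordinates, `w ↦ Lᵀ (√m w)`. -/
def constraintMap (m : Fin k → ℝ) (L : Matrix (Fin k) κ ℝ) :
    EuclideanSpace ℝ (Fin k) →ₗ[ℝ] (κ → ℝ) :=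
  Lᵀ.mulVecLin ∘ₗ (Matrix.diagonal fun i => √(m i)).mulVecLin ∘ₗ
    (WithLp.linearEquiv 2 ℝ (Fin k → ℝ)).toLinearMap

/-- The tangent space of `feasibleSet m V L` at `m`, in standardized coordinates. -/
def tangentSpaceAt (m : Fin k → ℝ) (V : Submodule ℝ (Fin k → ℝ)) (L : Matrix (Fin k) κ ℝ) :
    Submodule ℝ (EuclideanSpace ℝ (Fin k)) :=
  V.map (sqrtScale m) ⊓ LinearMap.ker (constraintMap m L)

/-- The derivative of the constraints as functions of the logarithms of the means. -/
def logConstraintMap (m : Fin k → ℝ) (V : Submodule ℝ (Fin k → ℝ)) (L : Matrix (Fin k) κ ℝ) :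
    V →ₗ[ℝ] (κ → ℝ) :=
  Lᵀ.mulVecLin ∘ₗ (Matrix.diagonal m).mulVecLin ∘ₗ V.subtype

variable {m : Fin k → ℝ} {V : Submodule ℝ (Fin k → ℝ)} {L : Matrix (Fin k) κ ℝ}

@[simp]
theorem sqrtScale_apply (ξ : Fin k → ℝ) (i : Fin k) : sqrtScale m ξ i = √(m i) * ξ i := by
  simp [sqrtScale, Matrix.mulVec_diagonal]

theorem constraintMap_apply (w : EuclideanSpace ℝ (Fin k)) :
    constraintMap m L w = Lᵀ *ᵥ fun i => √(m i) * w i := by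
  simp only [constraintMap, LinearMap.comp_apply, Matrix.mulVecLin_apply]
  congr 1
  ext i
  simp [Matrix.mulVec_diagonal]

theorem logConstraintMap_apply (ξ : V) :
    logConstraintMap m V L ξ = Lᵀ *ᵥ fun i => m i * (ξ : Fin k → ℝ) i := by
  simp only [logConstraintMap, LinearMap.comp_apply, Matrix.mulVecLin_apply]
  congr 1
  ext i
  simp [Matrix.mulVec_diagonal]

/-- This is the chain rule at `m`: `sqrtScale m` is the derivative of the passage from logarithmic
to standardized coordinates. -/
theorem constraintMap_sqrtScale (hm : ∀ i, 0 < m i) (ξ : V) :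
    constraintMap m L (sqrtScale m ξ) = logConstraintMap m V L ξ := by
  rw [constraintMap_apply, logConstraintMap_apply]
  congr 1
  ext i
  rw [sqrtScale_apply, ← mul_assoc, Real.mul_self_sqrt (hm i).le]

theorem constraintMap_standardize (hm : ∀ i, 0 < m i) (x : Fin k → ℝ) :
    constraintMap m L (standardize m x) = Lᵀ *ᵥ x - Lᵀ *ᵥ m := by
  rw [constraintMap_apply, ← Matrix.mulVec_sub]
  congr 1
  ext i
  have := (Real.sqrt_pos.2 (hm i)).ne'
  simp only [standardize, Pi.sub_apply]
  field_simp

theorem self_mem_feasibleSet (hm : ∀ i, 0 < m i) : m ∈ feasibleSet m V L :=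
  ⟨hm, by simp [fun i => div_self (hm i).ne', ← Pi.zero_def], rfl⟩

/-- Points of the feasible set near `m` lie close to the tangent space. -/
theorem isLittleO_standardize_sub_starProjection [Finite κ] (hm : ∀ i, 0 < m i)
    (hreg : Function.Surjective (logConstraintMap m V L)) {α : Type*} {l : Filter α}
    {x : α → Fin k → ℝ} (hx : Tendsto x l (𝓝 m)) (hxF : ∀ᶠ a in l, x a ∈ feasibleSet m V L) :
    (fun a => standardize m (x a) - (tangentSpaceAt m V L).starProjection (standardize m (x a)))
      =o[l] fun a => standardize m (x a) := by
  obtain ⟨B, hB⟩ := (logConstraintMap m V L).exists_rightInverse_of_surjective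
    (LinearMap.range_eq_top.2 hreg)
  set P := (tangentSpaceAt m V L).starProjection
  let v : α → EuclideanSpace ℝ (Fin k) := fun a =>
    sqrtScale m fun i => Real.log (x a i / m i)
  let E : EuclideanSpace ℝ (Fin k) →ₗ[ℝ] EuclideanSpace ℝ (Fin k) :=
    sqrtScale m ∘ₗ V.subtype ∘ₗ B ∘ₗ constraintMap m L
  let K : EuclideanSpace ℝ (Fin k) →ₗ[ℝ] EuclideanSpace ℝ (Fin k) :=
    (LinearMap.id - P.toLinearMap) ∘ₗ (LinearMap.id - E)
  have hAB : ∀ y, logConstraintMap m V L (B y) = y := fun y => LinearMap.congr_fun hB y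
  -- The vector `v`, built from logarithms, lies exactly in the image of `V`, while `u` satisfies
  -- the linear constraints exactly. Subtracting `E v` pushes `v` into the tangent space, and `E u =
  -- 0`. Thus the defect `u - P u` is a fixed linear function of `u - v`, which is of smaller order
  -- since `log y` is `y - 1` to first order at 1.
  have hkey : ∀ᶠ a in l, standardize m (x a) - P (standardize m (x a)) =
      K.toContinuousLinearMap (standardize m (x a) - v a) := by
    filter_upwards [hxF] with a ha
    set u := standardize m (x a)
    have hAu : constraintMap m L u = 0 := by
      rw [constraintMap_standardize hm, ha.2.2, sub_self]
    have hmem : v a - E (v a) ∈ tangentSpaceAt m V L := by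
      refine ⟨Submodule.sub_mem _ ⟨_, ha.2.1, rfl⟩ ⟨B (constraintMap m L (v a)),
        (B (constraintMap m L (v a))).2, rfl⟩, ?_⟩
      rw [SetLike.mem_coe, LinearMap.mem_ker, map_sub]
      change _ - constraintMap m L (sqrtScale m (B (constraintMap m L (v a)))) = 0
      rw [constraintMap_sqrtScale hm, hAB, sub_self]
    have hEu : E u = 0 := by
      simp [E, hAu]
    have hPv : P (v a - E (v a)) = v a - E (v a) := Submodule.starProjection_eq_self_iff.2 hmem
    have hsplit : (u - v a) - E (u - v a) = u - (v a - E (v a)) := by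
      rw [map_sub, hEu]
      abel
    change _ = ((u - v a) - E (u - v a)) - P ((u - v a) - E (u - v a))
    rw [hsplit, map_sub, hPv]
    abel
  have hlog : (fun y : ℝ => y - 1 - Real.log y) =o[𝓝 1] fun y => y - 1 := by
    have := (Real.hasDerivAt_log one_ne_zero).isLittleO
    simp only [Real.log_one, sub_zero, inv_one, smul_eq_mul, mul_one] at this
    exact this.neg_left.congr_left fun y => by ring
  have huv : (fun a => standardize m (x a) - v a) =o[l] fun a => standardize m (x a) := by
    have hcoord : ∀ i, (fun a => (standardize m (x a) - v a) i) =o[l]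
        fun a => standardize m (x a) := by
      intro i
      have hi : Tendsto (fun a => x a i / m i) l (𝓝 1) := by
        have := (tendsto_pi_nhds.1 hx i).div_const (m i)
        rwa [div_self (hm i).ne'] at this
      have hO : ((fun y => y - 1) ∘ fun a => x a i / m i) =O[l]
          fun a => standardize m (x a) i := by
        refine IsBigO.of_bound (√(m i))⁻¹ (Eventually.of_forall fun a => le_of_eq ?_)
        have h0 := Real.sqrt_pos.2 (hm i)
        simp only [Function.comp_apply, standardize, Real.norm_eq_abs, abs_div, abs_of_pos h0]
        rw [inv_mul_eq_div, div_div, Real.mul_self_sqrt (hm i).le]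
        rw [← abs_of_pos (hm i), ← abs_div, abs_of_pos (hm i), sub_div, div_self (hm i).ne']
      have h1 := ((hlog.comp_tendsto hi).const_mul_left (√(m i))).trans_isBigO hO
      have h3 : (fun a => standardize m (x a) i) =O[l] fun a => standardize m (x a) :=
        (IsBigO.of_norm_le fun a => PiLp.norm_apply_le (standardize m (x a)) i).of_norm_right
      refine (h1.trans_isBigO h3).congr_left fun a => ?_
      simp only [v, PiLp.sub_apply, sqrtScale_apply, standardize, Function.comp_apply]
      have := (Real.sqrt_pos.2 (hm i)).ne'
      have hsq := Real.mul_self_sqrt (hm i).le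
      have h2 : (x a i - m i) / √(m i) = √(m i) * (x a i / m i - 1) := by
        rw [div_eq_iff this, mul_right_comm, hsq]
        have := (hm i).ne'
        field_simp
      rw [h2]
      ring
    refine IsBigO.trans_isLittleO (g := fun a => ∑ i, ‖(standardize m (x a) - v a) i‖)
      (IsBigO.of_norm_le fun a => ?_)
      (IsLittleO.fun_sum fun i (_ : i ∈ Finset.univ) => (hcoord i).norm_left)
    rw [EuclideanSpace.norm_eq]
    refine Real.sqrt_le_iff.2 ⟨by positivity, ?_⟩
    exact Finset.sum_sq_le_sq_sum_of_nonneg fun i _ => norm_nonneg _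
  refine ((K.toContinuousLinearMap.isBigO_comp _ l).trans_isLittleO huv).congr' ?_
    EventuallyEq.rfl
  exact hkey.mono fun a ha => ha.symm

end Constraint
end

/-! ### Feasible points in prescribed tangent directions -/

noncomputable section

open Asymptotics Set

/-- A surjective derivative allows one to follow any direction in its kernel along a level set. -/
theorem exists_hasFDerivAt_of_comp_eq_zero {E F T : Type*} [NormedAddCommGroup E] [NormedSpace ℝ E]
    [CompleteSpace E] [NormedAddCommGroup F] [NormedSpace ℝ F] [FiniteDimensional ℝ F]
    [NormedAddCommGroup T] [NormedSpace ℝ T] {G : E → F} {A : E →L[ℝ] F} {a : E}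
    (hG : HasStrictFDerivAt G A a) (hA : A.range = ⊤) {J : T →L[ℝ] E} (hJ : A.comp J = 0) :
    ∃ h : T → E, HasFDerivAt h J 0 ∧ h 0 = a ∧ ∀ᶠ w in 𝓝 0, G (h w) = G a := by
  -- Since `J` takes values in the kernel of `A`, it can be fed to the implicit function, which
  -- parametrizes the level set by that kernel with the inclusion as derivative.
  let J' : T →L[ℝ] A.ker := J.codRestrict A.ker fun w => DFunLike.congr_fun hJ w
  have hJ0 : Tendsto J' (𝓝 0) (𝓝 0) := by simpa using J'.continuous.tendsto 0
  refine ⟨fun w => hG.implicitFunction G A hA (G a) (J' w), ?_, ?_, ?_⟩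
  · have hg : HasFDerivAt (hG.implicitFunction G A hA (G a)) A.ker.subtypeL (J' 0) := by
      rw [map_zero]
      exact (hG.to_implicitFunction hA).hasFDerivAt
    exact hg.comp 0 J'.hasFDerivAt
  · simp only [map_zero]
    exact hG.implicitFunction_apply_image hA
  · have h2 : Tendsto (fun w => (G a, J' w)) (𝓝 0) (𝓝 (G a, 0)) := by
      rw [nhds_prod_eq]
      exact tendsto_const_nhds.prodMk hJ0
    exact h2.eventually (hG.map_implicitFunction_eq hA)

section Constraint

variable {k : ℕ} {κ : Type*} {m : Fin k → ℝ} {V : Submodule ℝ (Fin k → ℝ)}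
  {L : Matrix (Fin k) κ ℝ}

/-- The constraints, as functions of the logarithms of the mean vectors. -/
def logConstraint (m : Fin k → ℝ) (V : Submodule ℝ (Fin k → ℝ)) (L : Matrix (Fin k) κ ℝ)
    (ξ : V) : κ → ℝ :=
  Lᵀ *ᵥ fun i => m i * Real.exp ((ξ : Fin k → ℝ) i)

theorem hasStrictFDerivAt_logConstraint [Fintype κ] :
    HasStrictFDerivAt (logConstraint m V L) (logConstraintMap m V L).toContinuousLinearMap 0 := by
  have hE : HasStrictFDerivAt (fun (ξ : V) i => m i * Real.exp ((ξ : Fin k → ℝ) i))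
      (ContinuousLinearMap.pi fun i =>
        m i • (ContinuousLinearMap.proj (R := ℝ) (φ := fun _ : Fin k => ℝ) i).comp V.subtypeL)
      0 := by
    refine hasStrictFDerivAt_pi.2 fun i => ?_
    have h1 : HasStrictFDerivAt (fun ξ : V => (ξ : Fin k → ℝ) i)
      ((ContinuousLinearMap.proj (R := ℝ) (φ := fun _ : Fin k => ℝ) i).comp V.subtypeL) 0 :=
      ((ContinuousLinearMap.proj (R := ℝ) (φ := fun _ : Fin k => ℝ) i).comp
        V.subtypeL).hasStrictFDerivAt
    simpa using h1.exp.const_mul (m i)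
  have h := (Lᵀ.mulVecLin.toContinuousLinearMap.hasStrictFDerivAt).comp (0 : V) hE
  refine h.congr_fderiv ?_
  ext1 ξ
  simp only [ContinuousLinearMap.comp_apply, LinearMap.coe_toContinuousLinearMap',
    logConstraintMap_apply, Matrix.mulVecLin_apply]
  rfl

/-- Every small tangent vector is approximated by a point of the feasible set. -/
theorem exists_feasible_approximation [Fintype κ] (hm : ∀ i, 0 < m i)
    (hreg : Function.Surjective (logConstraintMap m V L)) :
    ∃ y : tangentSpaceAt m V L → Fin k → ℝ, Tendsto y (𝓝 0) (𝓝 m) ∧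
      (∀ᶠ w in 𝓝 0, y w ∈ feasibleSet m V L) ∧
      (fun w => standardize m (y w) - (w : EuclideanSpace ℝ (Fin k))) =o[𝓝 0]
        fun w => (w : EuclideanSpace ℝ (Fin k)) := by
  have hG := hasStrictFDerivAt_logConstraint (m := m) (V := V) (L := L)
  -- Dividing by `√m` returns a tangent vector to logarithmic coordinates, where it is annihilated
  -- by the derivative of the constraints.
  have hmem : ∀ w : tangentSpaceAt m V L, ∃ ξ : V, logConstraintMap m V L ξ = 0 ∧
      (ξ : Fin k → ℝ) = fun i => (w : EuclideanSpace ℝ (Fin k)) i / √(m i) := by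
    rintro ⟨w, ⟨ξ, hξ, rfl⟩, hw⟩
    refine ⟨⟨ξ, hξ⟩, ?_, funext fun i => ?_⟩
    · rw [SetLike.mem_coe, LinearMap.mem_ker] at hw
      rw [← constraintMap_sqrtScale hm]
      exact hw
    · rw [sqrtScale_apply, mul_div_cancel_left₀ _ (Real.sqrt_pos.2 (hm i)).ne']
  choose J₀ hJker hJ₀ using hmem
  let J₁ : tangentSpaceAt m V L →ₗ[ℝ] V :=
    { toFun := J₀
      map_add' := fun w₁ w₂ => by
        refine Subtype.ext ?_
        rw [Submodule.coe_add, hJ₀, hJ₀, hJ₀]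
        funext i
        simp [add_div]
      map_smul' := fun c w => by
        refine Subtype.ext ?_
        rw [Submodule.coe_smul, hJ₀, hJ₀]
        funext i
        simp [mul_div_assoc] }
  obtain ⟨g, hg, hg0, hgc⟩ := exists_hasFDerivAt_of_comp_eq_zero hG (LinearMap.range_eq_top.2 hreg)
    (J := J₁.toContinuousLinearMap) (by ext1 w; exact hJker w)
  have hJ : ∀ w i, √(m i) * (J₁.toContinuousLinearMap w : Fin k → ℝ) i =
      (w : EuclideanSpace ℝ (Fin k)) i := by
    intro w i
    change √(m i) * (J₀ w : Fin k → ℝ) i = _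
    rw [hJ₀, mul_div_cancel₀ _ (Real.sqrt_pos.2 (hm i)).ne']
  let y : tangentSpaceAt m V L → Fin k → ℝ := fun w i => m i * Real.exp ((g w : Fin k → ℝ) i)
  have hcoord : ∀ i, HasFDerivAt (fun w => (g w : Fin k → ℝ) i)
      (((ContinuousLinearMap.proj (R := ℝ) (φ := fun _ : Fin k => ℝ) i).comp V.subtypeL).comp
        J₁.toContinuousLinearMap) 0 := fun i =>
    ((ContinuousLinearMap.proj (R := ℝ) (φ := fun _ : Fin k => ℝ) i).comp
        V.subtypeL).hasFDerivAt.comp 0 hg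
  -- The factors `√m` cancel, so the lifted map has the inclusion of the tangent space as its
  -- derivative at 0; this is the required approximation.
  have hψ : HasFDerivAt (fun w => standardize m (y w)) (tangentSpaceAt m V L).subtypeL 0 := by
    refine hasFDerivWithinAt_univ.1 ((hasFDerivWithinAt_piLp 2).2 fun i => hasFDerivWithinAt_univ.2 ?_)
    have h1 := (((hcoord i).exp.const_mul (m i)).sub_const (m i)).mul_const (√(m i))⁻¹
    refine (h1.congr_fderiv ?_).congr_of_eventuallyEq
      (Eventually.of_forall fun w => by simp [standardize, y, div_eq_mul_inv])
    ext1 w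
    have h2 := hJ w i
    have h3 := Real.mul_self_sqrt (hm i).le
    have h4 := (Real.sqrt_pos.2 (hm i)).ne'
    simp only [hg0, _root_.smul_apply, ContinuousLinearMap.comp_apply,
      Submodule.subtypeL_apply, ContinuousLinearMap.proj_apply, PiLp.proj_apply, smul_eq_mul,
      ZeroMemClass.coe_zero, Pi.zero_apply, Real.exp_zero, one_mul]
    rw [← h2, inv_mul_eq_div, div_eq_iff h4]
    linear_combination (-(J₁.toContinuousLinearMap w : Fin k → ℝ) i) * h3
  have hy0 : y 0 = m := by
    funext i
    simp only [y, hg0, ZeroMemClass.coe_zero, Pi.zero_apply, Real.exp_zero, mul_one]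
  refine ⟨y, ?_, ?_, ?_⟩
  · have : ContinuousAt y 0 := continuousAt_pi.2 fun i =>
      ((hcoord i).continuousAt.rexp).const_mul (m i)
    rw [ContinuousAt, hy0] at this
    exact this
  · filter_upwards [hgc] with w hw
    refine ⟨fun i => mul_pos (hm i) (Real.exp_pos _), ?_, ?_⟩
    · convert! (g w).2 using 1
      funext i
      simp [y, mul_div_cancel_left₀ _ (hm i).ne']
    · simpa [logConstraint] using hw
  · have := hψ.isLittleO
    simp only [hy0, standardize_self, sub_zero, Submodule.subtypeL_apply] at this
    exact IsLittleO.of_norm_right (g' := fun w : tangentSpaceAt m V L =>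
      (w : EuclideanSpace ℝ (Fin k))) this.norm_right

end Constraint

/-! ### Approximate minimizers of a distance and orthogonal projections -/

section Projection

/-- Factor the difference of squares: one factor is of order `‖q‖`, the other of smaller order by
the reverse triangle inequality. -/
theorem isLittleO_norm_sq_sub_norm_sq {E α : Type*} [NormedAddCommGroup E] {l : Filter α}
    {q u v : α → E} (hu : u =O[l] q)
    (huv : (fun a => u a - v a) =o[l] q) :
    (fun a => ‖u a‖ ^ 2 - ‖v a‖ ^ 2) =o[l] fun a => ‖q a‖ ^ 2 := by
  have hv : v =O[l] q := by
    simpa using hu.sub huv.isBigO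
  have h1 : (fun a => ‖u a‖ - ‖v a‖) =o[l] fun a => ‖q a‖ :=
    (IsBigO.of_norm_le fun a => (abs_norm_sub_norm_le (u a) (v a))).trans_isLittleO huv.norm_norm
  have h2 : (fun a => ‖u a‖ + ‖v a‖) =O[l] fun a => ‖q a‖ := hu.norm_norm.add hv.norm_norm
  exact (h2.mul_isLittleO h1).congr (fun a => by ring) fun a => by ring

variable {E : Type*} [NormedAddCommGroup E] [InnerProductSpace ℝ E] {T : Submodule ℝ E}
  [T.HasOrthogonalProjection] {α : Type*} {l : Filter α} {q x y : α → E}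

/-- An approximate minimizer of the distance to `q` among vectors close to a subspace is close to
the orthogonal projection of `q`. -/
theorem isLittleO_sub_starProjection_of_le (hx : x =O[l] q)
    (hxT : (fun a => x a - T.starProjection (x a)) =o[l] q)
    (hy : (fun a => y a - T.starProjection (q a)) =o[l] q) {e : α → ℝ}
    (he : e =o[l] fun a => ‖q a‖ ^ 2)
    (hle : ∀ᶠ a in l, ‖q a - x a‖ ^ 2 ≤ ‖q a - y a‖ ^ 2 + e a) :
    (fun a => x a - T.starProjection (q a)) =o[l] q := by
  have hPq : (fun a => T.starProjection (q a)) =O[l] q := T.starProjection.isBigO_comp q l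
  have h1 : (fun a => ‖q a - x a‖ ^ 2 - ‖q a - T.starProjection (x a)‖ ^ 2) =o[l]
      fun a => ‖q a‖ ^ 2 :=
    isLittleO_norm_sq_sub_norm_sq ((isBigO_refl q l).sub hx)
      (hxT.neg_left.congr_left fun a => by abel)
  have h2 : (fun a => ‖q a - T.starProjection (q a)‖ ^ 2 - ‖q a - y a‖ ^ 2) =o[l]
      fun a => ‖q a‖ ^ 2 :=
    isLittleO_norm_sq_sub_norm_sq ((isBigO_refl q l).sub hPq)
      (hy.congr_left fun a => by abel)
  have hpyth : ∀ a, ‖q a - T.starProjection (x a)‖ ^ 2 =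
      ‖q a - T.starProjection (q a)‖ ^ 2 +
        ‖T.starProjection (x a) - T.starProjection (q a)‖ ^ 2 := by
    intro a
    have horth : inner ℝ (q a - T.starProjection (q a))
        (T.starProjection (q a) - T.starProjection (x a)) = 0 := by
      refine Submodule.inner_left_of_mem_orthogonal (K := T) ?_
        (Submodule.sub_starProjection_mem_orthogonal _)
      exact T.sub_mem (Submodule.starProjection_apply_mem _ _)
        (Submodule.starProjection_apply_mem _ _)
    have := norm_add_sq_eq_norm_sq_add_norm_sq_of_inner_eq_zero _ _ horth
    rw [sub_add_sub_cancel] at this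
    rw [norm_sub_rev (T.starProjection (x a))]
    linarith [this]
  -- By Pythagoras the left side is the excess of the squared distance from `q` to `P x` over the
  -- minimal one, at `P q`. Replacing `P x` by `x`, comparing `x` with `y`, and replacing `y` by `P
  -- q` each contribute a negligible error.
  have h3 : (fun a => ‖T.starProjection (x a) - T.starProjection (q a)‖ ^ 2) =o[l]
      fun a => ‖q a‖ ^ 2 := by
    refine IsBigO.trans_isLittleO (g := fun a => ‖e a‖ +
      ‖‖q a - x a‖ ^ 2 - ‖q a - T.starProjection (x a)‖ ^ 2‖ +
      ‖‖q a - T.starProjection (q a)‖ ^ 2 - ‖q a - y a‖ ^ 2‖) ?_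
      ((he.norm_left.add h1.norm_left).add h2.norm_left)
    refine IsBigO.of_bound 1 ?_
    filter_upwards [hle] with a ha
    rw [one_mul, Real.norm_of_nonneg (by positivity), Real.norm_of_nonneg (by positivity)]
    have e1 := le_abs_self (e a)
    have e2 := neg_abs_le (‖q a - x a‖ ^ 2 - ‖q a - T.starProjection (x a)‖ ^ 2)
    have e3 := neg_abs_le (‖q a - T.starProjection (q a)‖ ^ 2 - ‖q a - y a‖ ^ 2)
    simp only [Real.norm_eq_abs]
    have := hpyth a
    linarith
  have h4 : (fun a => T.starProjection (x a) - T.starProjection (q a)) =o[l] q := by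
    exact (IsLittleO.of_pow (n := 2) h3 two_ne_zero).of_norm_norm
  exact (hxT.add h4).congr_left fun a => by abel

end Projection
end

/-! ### Existence and first order expansion of minimum divergence estimates -/

noncomputable section

open Asymptotics Set

/-- `x` minimizes the divergence from `p` over the set `F` of mean vectors. -/
def IsDivergenceMinimizer {k : ℕ} (φ : ℝ → EReal) (p : Fin k → ℝ) (F : Set (Fin k → ℝ))
    (x : Fin k → ℝ) : Prop :=
  x ∈ F ∧ ∀ y ∈ F, realDivergence φ p x ≤ realDivergence φ p y

section Estimator

variable {k : ℕ} {κ : Type*} {m : Fin k → ℝ} {V : Submodule ℝ (Fin k → ℝ)}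
  {L : Matrix (Fin k) κ ℝ} {φ : ℝ → EReal} {α : Type*} {l : Filter α} {p x : α → Fin k → ℝ}

theorem isBigO_realDivergence_self (hφ : IsDivergenceGenerator φ) (hm : ∀ i, 0 < m i)
    (hp : Tendsto p l (𝓝 m)) :
    (fun a => realDivergence φ (p a) m) =O[l] fun a => ‖standardize m (p a)‖ ^ 2 := by
  have h := (hφ.isLittleO_realDivergence hm hp (tendsto_const_nhds (x := m))).isBigO
  simp only [standardize_self, sub_zero] at h
  simpa using h.add ((isBigO_refl (fun a => ‖standardize m (p a)‖ ^ 2) l).const_mul_left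
    (secondDerivOne φ / 2))

theorem tendsto_standardize (hp : Tendsto p l (𝓝 m)) :
    Tendsto (fun a => standardize m (p a)) l (𝓝 0) := by
  rw [← standardize_self m]
  exact ((continuous_standardize m).tendsto m).comp hp

/-- Consistency: `m` is itself feasible, so a minimizer has divergence at most that of `m`, which
tends to zero as the data tend to `m`. -/
theorem tendsto_of_realDivergence_le (hφ : IsDivergenceGenerator φ) (hm : ∀ i, 0 < m i)
    (hp : Tendsto p l (𝓝 m))
    (hx : ∀ᶠ a in l, (∀ i, 0 < x a i) ∧ realDivergence φ (p a) (x a) ≤ realDivergence φ (p a) m) :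
    Tendsto x l (𝓝 m) := by
  refine hφ.tendsto_of_realDivergence hm hp (hx.mono fun a ha => ha.1) ?_
  have h1 : Tendsto (fun a => realDivergence φ (p a) m) l (𝓝 0) := by
    refine (isBigO_realDivergence_self hφ hm hp).trans_tendsto ?_
    simpa using ((tendsto_standardize hp).norm).pow 2
  have hpos : ∀ᶠ a in l, ∀ i, 0 < p a i :=
    eventually_all.2 fun i => (tendsto_pi_nhds.1 hp i).eventually_const_lt (hm i)
  refine tendsto_of_tendsto_of_tendsto_of_le_of_le' tendsto_const_nhds h1 ?_
    (hx.mono fun a ha => ha.2)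
  filter_upwards [hx, hpos] with a ha hpa
  exact hφ.realDivergence_nonneg hpa ha.1

theorem continuousOn_realDivergence (hφ : IsDivergenceGenerator φ) {p : Fin k → ℝ}
    (hp : ∀ i, 0 < p i) : ContinuousOn (realDivergence φ p) {x | ∀ i, 0 < x i} := by
  unfold realDivergence
  refine continuousOn_finsetSum _ fun i _ => ?_
  have h0 : ContinuousOn (fun x : Fin k → ℝ => x i) {x | ∀ i, 0 < x i} :=
    (continuous_apply i).continuousOn
  refine h0.mul (ContinuousOn.comp (t := Ioi 0) (g := realGenerator φ) (fun y hy =>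
    (hφ.differentiableAt hy).continuousAt.continuousWithinAt) ?_ fun x hx =>
      div_pos (hp i) (hx i))
  exact continuousOn_const.div h0 fun x hx => (hx i).ne'

/-- Near `m`, a minimum divergence estimate exists. -/
theorem eventually_exists_isDivergenceMinimizer (hφ : IsDivergenceGenerator φ)
    (hm : ∀ i, 0 < m i) :
    ∀ᶠ p in 𝓝 m, ∃ x, IsDivergenceMinimizer φ p (feasibleSet m V L) x := by
  have hopen : IsOpen {x : Fin k → ℝ | ∀ i, 0 < x i} := by
    simp only [Set.ofPred_forall]
    exact isOpen_iInter_of_finite fun i => isOpen_lt continuous_const (continuous_apply i)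
  obtain ⟨r, hr, hball⟩ := Metric.nhds_basis_closedBall.mem_iff.1 (hopen.mem_nhds hm)
  -- Consistency along the filter of all pairs `(p, x)` with `p → m` and `x` no worse than `m` makes
  -- the neighbourhood of `p` independent of `x`.
  have hnear : ∀ᶠ p in 𝓝 m, ∀ x : Fin k → ℝ, ((∀ i, 0 < x i) ∧
      realDivergence φ p x ≤ realDivergence φ p m) → x ∈ Metric.closedBall m r := by
    let S : Set ((Fin k → ℝ) × (Fin k → ℝ)) :=
      {z | (∀ i, 0 < z.2 i) ∧ realDivergence φ z.1 z.2 ≤ realDivergence φ z.1 m}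
    have h1 : Tendsto Prod.snd (comap Prod.fst (𝓝 m) ⊓ 𝓟 S) (𝓝 m) :=
      tendsto_of_realDivergence_le hφ hm (tendsto_comap.mono_left inf_le_left)
        (eventually_inf_principal.2 (Eventually.of_forall fun z hz => hz))
    have h2 := h1.eventually (Metric.closedBall_mem_nhds m hr)
    rw [eventually_inf_principal, eventually_comap] at h2
    exact h2.mono fun p hp x hx => hp (p, x) rfl hx
  have hlog : ContinuousOn (fun (x : Fin k → ℝ) i => Real.log (x i / m i))
      (Metric.closedBall m r) := by
    refine continuousOn_pi.2 fun i => ContinuousOn.log ?_ fun x hx =>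
      (div_pos (hball hx i) (hm i)).ne'
    exact ((continuous_apply i).div_const _).continuousOn
  -- The closed ball lies in the open positive orthant, so the logarithmic condition is closed there
  -- and the minimum over the ball is attained. Points outside are worse than `m`.
  have hcomp : IsCompact (Metric.closedBall m r ∩ feasibleSet m V L) := by
    have h1 : IsClosed (Metric.closedBall m r ∩
        (fun (x : Fin k → ℝ) i => Real.log (x i / m i)) ⁻¹' V) :=
      hlog.preimage_isClosed_of_isClosed Metric.isClosed_closedBall
        V.closed_of_finiteDimensional
    have h2 : IsClosed {x : Fin k → ℝ | Lᵀ *ᵥ x = Lᵀ *ᵥ m} :=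
      isClosed_eq (Continuous.matrix_mulVec continuous_const continuous_id) continuous_const
    refine (isCompact_closedBall m r).of_isClosed_subset ?_ inter_subset_left
    have heq : Metric.closedBall m r ∩ feasibleSet m V L = Metric.closedBall m r ∩
        (fun (x : Fin k → ℝ) i => Real.log (x i / m i)) ⁻¹' V ∩ {x | Lᵀ *ᵥ x = Lᵀ *ᵥ m} :=
      Subset.antisymm (fun x hx => ⟨⟨hx.1, hx.2.2.1⟩, hx.2.2.2⟩)
        fun x hx => ⟨hx.1.1, hball hx.1.1, hx.1.2, hx.2⟩
    rw [heq]
    exact h1.inter h2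
  have hpos : ∀ᶠ p in 𝓝 m, ∀ i, 0 < p i := hopen.mem_nhds hm
  filter_upwards [hnear, hpos] with p hp hpp
  have hmF : m ∈ Metric.closedBall m r ∩ feasibleSet m V L :=
    ⟨Metric.mem_closedBall_self hr.le, self_mem_feasibleSet hm⟩
  obtain ⟨x, hx, hmin⟩ := hcomp.exists_isMinOn ⟨m, hmF⟩
    ((continuousOn_realDivergence hφ hpp).mono fun x hx => hball hx.1)
  refine ⟨x, hx.2, fun y hy => ?_⟩
  by_cases hle : realDivergence φ p y ≤ realDivergence φ p m
  · exact hmin ⟨hp y ⟨hy.1, hle⟩, hy⟩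
  · exact (hmin hmF).trans (not_le.1 hle).le

/-- First order expansion of minimum divergence estimates: in standardized coordinates they are
the orthogonal projections to the tangent space. -/
theorem isLittleO_standardize_minimizer [Fintype κ] (hφ : IsDivergenceGenerator φ)
    (hm : ∀ i, 0 < m i) (hreg : Function.Surjective (logConstraintMap m V L))
    (hp : Tendsto p l (𝓝 m))
    (hx : ∀ᶠ a in l, IsDivergenceMinimizer φ (p a) (feasibleSet m V L) (x a)) :
    Tendsto x l (𝓝 m) ∧
    (fun a => standardize m (x a) -
      (tangentSpaceAt m V L).starProjection (standardize m (p a))) =o[l]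
      fun a => standardize m (p a) := by
  have hκ := hφ.secondDerivOne_pos
  have hxm : Tendsto x l (𝓝 m) := tendsto_of_realDivergence_le hφ hm hp
    (hx.mono fun a ha => ⟨ha.1.1, ha.2 m (self_mem_feasibleSet hm)⟩)
  refine ⟨hxm, ?_⟩
  set q := fun a => standardize m (p a)
  set u := fun a => standardize m (x a)
  set T := tangentSpaceAt m V L
  have hexp := hφ.isLittleO_realDivergence hm hp hxm
  have hpos : ∀ᶠ a in l, ∀ i, 0 < p a i :=
    eventually_all.2 fun i => (tendsto_pi_nhds.1 hp i).eventually_const_lt (hm i)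
  -- Localization to the right scale: `‖q - u‖ ^ 2` is controlled by the divergence at the
  -- minimizer, which is at most the divergence at `m`, of order `‖q‖ ^ 2`.
  have hqu : (fun a => q a - u a) =O[l] q := by
    have h1 : (fun a => ‖q a - u a‖ ^ 2) =O[l] fun a => realDivergence φ (p a) (x a) := by
      have h2 := isLittleO_iff.1 hexp (c := secondDerivOne φ / 4) (by positivity)
      refine IsBigO.of_bound (4 / secondDerivOne φ) ?_
      filter_upwards [h2] with a ha
      rw [Real.norm_eq_abs, Real.norm_of_nonneg (sq_nonneg _)] at ha
      have h3 := (abs_le.1 ha).1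
      have h4 := le_abs_self (realDivergence φ (p a) (x a))
      rw [Real.norm_of_nonneg (sq_nonneg _), div_mul_eq_mul_div, le_div_iff₀ hκ, Real.norm_eq_abs]
      linarith
    have h5 : (fun a => realDivergence φ (p a) (x a)) =O[l] fun a => realDivergence φ (p a) m := by
      refine IsBigO.of_bound 1 ?_
      filter_upwards [hx, hpos] with a ha hpa
      rw [one_mul, Real.norm_of_nonneg (hφ.realDivergence_nonneg hpa ha.1.1),
        Real.norm_of_nonneg (hφ.realDivergence_nonneg hpa hm)]
      exact ha.2 m (self_mem_feasibleSet hm)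
    have h6 : (fun a => ‖q a - u a‖ ^ 2) =O[l] fun a => ‖q a‖ ^ 2 :=
      (h1.trans h5).trans (isBigO_realDivergence_self hφ hm hp)
    exact (IsBigO.of_pow (n := 2) two_ne_zero h6).of_norm_norm
  have hu : u =O[l] q := by simpa using (isBigO_refl q l).sub hqu
  have huT : (fun a => u a - T.starProjection (u a)) =o[l] q :=
    (isLittleO_standardize_sub_starProjection hm hreg hxm (hx.mono fun a ha => ha.1)).trans_isBigO hu
  obtain ⟨Y, hY, hYF, hYo⟩ := exists_feasible_approximation (V := V) (L := L) hm hreg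
  have hq0 : Tendsto q l (𝓝 0) := tendsto_standardize hp
  -- The competitor is the feasible point that follows the projection of `q`. Minimality against it
  -- is the inequality required of an approximate projection.
  let w : α → T := fun a => T.orthogonalProjectionOnto (q a)
  have hw0 : Tendsto w l (𝓝 0) := by
    have := (T.orthogonalProjectionOnto.continuous.tendsto 0).comp hq0
    rwa [map_zero] at this
  have hwq : (fun a => (w a : EuclideanSpace ℝ (Fin k))) =O[l] q := T.starProjection.isBigO_comp q l
  have hYw : (fun a => standardize m (Y (w a)) - T.starProjection (q a)) =o[l] q :=
    (hYo.comp_tendsto hw0).trans_isBigO hwq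
  have hYm : Tendsto (fun a => Y (w a)) l (𝓝 m) := hY.comp hw0
  have hexpY := hφ.isLittleO_realDivergence hm hp hYm
  have hYO : (fun a => standardize m (Y (w a))) =O[l] q := by
    exact (hYw.isBigO.add hwq).congr_left fun a => sub_add_cancel _ _
  have hqY : (fun a => q a - standardize m (Y (w a))) =O[l] q := (isBigO_refl q l).sub hYO
  have he1 := hexp.trans_isBigO (hqu.norm_norm.pow 2)
  have he2 := hexpY.trans_isBigO (hqY.norm_norm.pow 2)
  refine isLittleO_sub_starProjection_of_le hu huT hYw
    ((he2.sub he1).const_mul_left (2 / secondDerivOne φ)) ?_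
  filter_upwards [hx, hw0.eventually hYF] with a ha hYa
  have hle := ha.2 _ hYa
  have h2 : 2 / secondDerivOne φ * (secondDerivOne φ / 2) = 1 := by field_simp
  have h3 := mul_le_mul_of_nonneg_left hle (show 0 ≤ 2 / secondDerivOne φ by positivity)
  linear_combination h3 - (‖q a - u a‖ ^ 2 - ‖q a - standardize m (Y (w a))‖ ^ 2) * h2

/-- The divergence statistic between the minimum divergence estimates in two models is, up to a
smaller order term, the squared length of a difference of projections of the data. -/
theorem eventually_abs_divergence_sub_le {κ' : Type*} [Fintype κ] [Fintype κ']
    {V' : Submodule ℝ (Fin k → ℝ)} {L' : Matrix (Fin k) κ' ℝ} {φ₁ : ℝ → EReal}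
    (hφ₁ : IsDivergenceGenerator φ₁) (hφ : IsDivergenceGenerator φ)
    (hm : ∀ i, 0 < m i) (hreg : Function.Surjective (logConstraintMap m V L))
    (hreg' : Function.Surjective (logConstraintMap m V' L')) {ε : ℝ} (hε : 0 < ε) :
    ∀ᶠ p in 𝓝 m, ∀ x x', IsDivergenceMinimizer φ p (feasibleSet m V L) x →
      IsDivergenceMinimizer φ p (feasibleSet m V' L') x' →
      |2 / secondDerivOne φ₁ * realDivergence φ₁ x x' -
        ‖(tangentSpaceAt m V L).starProjection (standardize m p) -
          (tangentSpaceAt m V' L').starProjection (standardize m p)‖ ^ 2| ≤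
        ε * ‖standardize m p‖ ^ 2 := by
  have hκ := hφ₁.secondDerivOne_pos
  -- Collecting all triples of data and minimizers in one filter gives an error bound uniform over
  -- both minimizers.
  let S : Set ((Fin k → ℝ) × (Fin k → ℝ) × (Fin k → ℝ)) :=
    {z | IsDivergenceMinimizer φ z.1 (feasibleSet m V L) z.2.1 ∧
      IsDivergenceMinimizer φ z.1 (feasibleSet m V' L') z.2.2}
  set l : Filter ((Fin k → ℝ) × (Fin k → ℝ) × (Fin k → ℝ)) := comap Prod.fst (𝓝 m) ⊓ 𝓟 S
  have hp : Tendsto Prod.fst l (𝓝 m) := tendsto_comap.mono_left inf_le_left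
  have hS : ∀ᶠ z in l, z ∈ S :=
    eventually_inf_principal.2 (Eventually.of_forall fun z hz => hz)
  obtain ⟨hx, hxo⟩ := isLittleO_standardize_minimizer hφ hm hreg hp (hS.mono fun z hz => hz.1)
  obtain ⟨hx', hxo'⟩ := isLittleO_standardize_minimizer hφ hm hreg' hp (hS.mono fun z hz => hz.2)
  have hexp := hφ₁.isLittleO_realDivergence hm hx hx'
  set T := tangentSpaceAt m V L
  set T' := tangentSpaceAt m V' L'
  set q : (Fin k → ℝ) × (Fin k → ℝ) × (Fin k → ℝ) → _ := fun z => standardize m z.1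
  have hT : (fun z => T.starProjection (q z)) =O[l] q := T.starProjection.isBigO_comp q l
  have hT' : (fun z => T'.starProjection (q z)) =O[l] q := T'.starProjection.isBigO_comp q l
  have hd : (fun z => (standardize m z.2.1 - standardize m z.2.2) -
      (T.starProjection (q z) - T'.starProjection (q z))) =o[l] q :=
    (hxo.sub hxo').congr_left fun z => by abel
  have hO : (fun z : (Fin k → ℝ) × (Fin k → ℝ) × (Fin k → ℝ) =>
      standardize m z.2.1 - standardize m z.2.2) =O[l] q := by
    simpa using hd.isBigO.add (hT.sub hT')
  have h1 := isLittleO_norm_sq_sub_norm_sq hO hd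
  have h2 := (hexp.trans_isBigO (hO.norm_norm.pow 2)).const_mul_left (2 / secondDerivOne φ₁)
  have h3 : (fun z : (Fin k → ℝ) × (Fin k → ℝ) × (Fin k → ℝ) =>
      2 / secondDerivOne φ₁ * realDivergence φ₁ z.2.1 z.2.2 -
      ‖T.starProjection (q z) - T'.starProjection (q z)‖ ^ 2) =o[l] fun z => ‖q z‖ ^ 2 := by
    refine (h1.add h2).congr_left fun z => ?_
    field_simp
    ring
  have h4 := isLittleO_iff.1 h3 hε
  rw [eventually_inf_principal, eventually_comap] at h4
  refine h4.mono fun p hp x x' hx hx' => ?_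
  have := hp (p, x, x') rfl ⟨hx, hx'⟩
  rwa [Real.norm_eq_abs, Real.norm_of_nonneg (by positivity)] at this

end Estimator
end

/-! ### Generating functions of the sampling laws -/

noncomputable section

-- This is the multinomial theorem divided by `T!`; it evaluates the Poisson weights on the tables
-- with a fixed total.
open Finset in
theorem sum_piAntidiag_prod_pow_div_factorial {ι : Type*} [DecidableEq ι] (S : Finset ι)
    (a : ι → ℂ) (T : ℕ) :
    ∑ κ ∈ piAntidiag S T, ∏ i ∈ S, a i ^ κ i / (κ i).factorial =
      (∑ i ∈ S, a i) ^ T / T.factorial := by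
  rw [sum_pow_eq_sum_piAntidiag, sum_div]
  refine sum_congr rfl fun κ hκ => ?_
  have hT : ∑ i ∈ S, κ i = T := (mem_piAntidiag.1 hκ).1
  have h := Nat.multinomial_spec S κ
  rw [hT] at h
  have h' : (∏ i ∈ S, ((κ i).factorial : ℂ)) * (Nat.multinomial S κ : ℂ) = (T.factorial : ℂ) := by
    exact_mod_cast h
  have h1 : (∏ i ∈ S, ((κ i).factorial : ℂ)) ≠ 0 :=
    prod_ne_zero_iff.2 fun i _ => by exact_mod_cast (κ i).factorial_ne_zero
  have h2 : (T.factorial : ℂ) ≠ 0 := by exact_mod_cast T.factorial_ne_zero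
  rw [prod_div_distrib, div_eq_div_iff h1 h2, ← h']
  ring

section GeneratingFunction

variable {k c : ℕ}

/-- The tables with subtable totals `tot`, when cell `i` lies in the subtable `s i`. -/
def tablesWithTotals (s : Fin k → Fin c) (tot : Fin c → ℕ) : Finset (Fin k → ℕ) :=
  (Fintype.piFinset fun h => Finset.piAntidiag (Finset.univ.filter fun i => s i = h) (tot h)).image
    fun x i => x (s i) i

theorem mem_tablesWithTotals {s : Fin k → Fin c} {tot : Fin c → ℕ} {n : Fin k → ℕ} :
    n ∈ tablesWithTotals s tot ↔
      ∀ h, ∑ i ∈ Finset.univ.filter (fun i => s i = h), n i = tot h := by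
  simp only [tablesWithTotals, Finset.mem_image, Fintype.mem_piFinset, Finset.mem_piAntidiag,
    Finset.mem_filter, Finset.mem_univ, true_and]
  constructor
  · rintro ⟨x, hx, rfl⟩ h
    rw [← (hx h).1]
    refine Finset.sum_congr rfl fun i hi => ?_
    simp only [(Finset.mem_filter.1 hi).2]
  · intro hn
    -- Extension by zero outside each subtable makes the splitting of a table into subtables unique.
    refine ⟨fun h i => if s i = h then n i else 0, fun h => ⟨?_, fun i hi => ?_⟩, ?_⟩
    · rw [← hn h]
      exact Finset.sum_congr rfl fun i hi => if_pos (Finset.mem_filter.1 hi).2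
    · by_contra hne
      exact hi (if_neg hne)
    · funext i
      simp

/-- Cells in different subtables are constrained separately, so the sum factors over the subtables.
-/
theorem sum_tablesWithTotals (s : Fin k → Fin c) (tot : Fin c → ℕ) (g : Fin k → ℕ → ℂ) :
    ∑ n ∈ tablesWithTotals s tot, ∏ i, g i (n i) =
      ∏ h, ∑ κ ∈ Finset.piAntidiag (Finset.univ.filter fun i => s i = h) (tot h),
        ∏ i ∈ Finset.univ.filter (fun i => s i = h), g i (κ i) := by
  rw [Finset.prod_univ_sum, tablesWithTotals, Finset.sum_image]
  · refine Finset.sum_congr rfl fun x _ => ?_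
    rw [← Finset.prod_fiberwise Finset.univ s]
    refine Finset.prod_congr rfl fun h _ => Finset.prod_congr rfl fun i hi => ?_
    simp only [(Finset.mem_filter.1 hi).2]
  · intro x hx y hy hxy
    funext h i
    have hx' := Finset.mem_piAntidiag.1 (Fintype.mem_piFinset.1 hx h)
    have hy' := Finset.mem_piAntidiag.1 (Fintype.mem_piFinset.1 hy h)
    by_cases hi : s i = h
    · subst hi
      exact congrFun hxy i
    · have h1 : x h i = 0 := by
        by_contra hne
        exact hi (Finset.mem_filter.1 (hx'.2 i hne)).2
      have h2 : y h i = 0 := by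
        by_contra hne
        exact hi (Finset.mem_filter.1 (hy'.2 i hne)).2
      rw [h1, h2]

theorem integrableOn_finset {α E : Type*} [MeasurableSpace α] [MeasurableSingletonClass α]
    [NormedAddCommGroup E] {μ : Measure α} [IsFiniteMeasure μ] (S : Finset α) (f : α → E) :
    IntegrableOn f S μ := by
  rw [← Set.biUnion_of_singleton (S : Set α), integrableOn_finite_biUnion S.finite_toSet]
  exact fun a _ => integrableOn_singleton (by simp)

theorem setIntegral_prod_pow_poisson (s : Fin k → Fin c) (tot : Fin c → ℕ) (lam : Fin k → NNReal)
    (z : Fin k → ℂ) :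
    ∫ n in (tablesWithTotals s tot : Set (Fin k → ℕ)), ∏ i, z i ^ n i
        ∂(Measure.pi fun i => poissonMeasure (lam i)) =
      (∏ i, Complex.exp (-(lam i : ℝ))) *
        ∏ h, ((∑ i ∈ Finset.univ.filter (fun i => s i = h), (lam i : ℝ) * z i) ^ tot h /
          (tot h).factorial) := by
  rw [setIntegral_finset _ (integrableOn_finset _ _)]
  have hterm : ∀ n : Fin k → ℕ, (Measure.pi fun i => poissonMeasure (lam i)).real {n} •
      ∏ i, z i ^ n i = ∏ i, Complex.exp (-(lam i : ℝ)) *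
        (((lam i : ℝ) * z i) ^ n i / (n i).factorial) := by
    intro n
    rw [measureReal_def, Measure.pi_singleton, ENNReal.toReal_prod, Complex.real_smul,
      Complex.ofReal_prod, ← Finset.prod_mul_distrib]
    refine Finset.prod_congr rfl fun i _ => ?_
    rw [← measureReal_def, poissonMeasure_real_singleton]
    push_cast
    rw [mul_pow]
    ring
  rw [Finset.sum_congr rfl fun n _ => hterm n]
  rw [sum_tablesWithTotals s tot fun i j => Complex.exp (-(lam i : ℝ)) *
    (((lam i : ℝ) * z i) ^ j / j.factorial)]
  rw [← Finset.prod_fiberwise Finset.univ s fun i => Complex.exp (-(lam i : ℝ)),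
    ← Finset.prod_mul_distrib]
  refine Finset.prod_congr rfl fun h _ => ?_
  rw [← sum_piAntidiag_prod_pow_div_factorial, Finset.mul_sum]
  exact Finset.sum_congr rfl fun κ _ => Finset.prod_mul_distrib

/-- The normalizing mass is the same expression at `z = 1`, where the subtable sums of the means are
the prefixed totals. Exponentials and factorials then cancel. Surjectivity of `s` and positive means
make every total nonzero. -/
theorem integral_prod_pow_cond_poisson {s : Fin k → Fin c} {tot : Fin c → ℕ}
    {lam : Fin k → NNReal} (hs : Function.Surjective s) (hlam : ∀ i, 0 < lam i)
    (htot : ∀ h, ∑ i ∈ Finset.univ.filter (fun i => s i = h), (lam i : ℝ) = tot h)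
    (z : Fin k → ℂ) :
    ∫ n, ∏ i, z i ^ n i ∂(ProbabilityTheory.cond (Measure.pi fun i => poissonMeasure (lam i))
        (tablesWithTotals s tot : Set (Fin k → ℕ))) =
      ∏ h, ((∑ i ∈ Finset.univ.filter (fun i => s i = h), (lam i : ℝ) * z i) / tot h) ^ tot h := by
  have htotC : ∀ h, ∑ i ∈ Finset.univ.filter (fun i => s i = h), ((lam i : ℝ) : ℂ) = tot h := by
    intro h
    exact_mod_cast congrArg (fun x : ℝ => (x : ℂ)) (htot h)
  have htot0 : ∀ h, (tot h : ℂ) ≠ 0 := by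
    intro h
    obtain ⟨i, hi⟩ := hs h
    have : 0 < ∑ i ∈ Finset.univ.filter (fun i => s i = h), (lam i : ℝ) :=
      Finset.sum_pos (fun i _ => by exact_mod_cast hlam i) ⟨i, by simp [hi]⟩
    rw [htot h] at this
    exact_mod_cast this.ne'
  have hmass := setIntegral_prod_pow_poisson s tot lam (fun _ => 1)
  simp only [one_pow, Finset.prod_const_one, mul_one, htotC] at hmass
  rw [setIntegral_const, Complex.real_smul, mul_one] at hmass
  rw [ProbabilityTheory.cond, integral_smul_measure, setIntegral_prod_pow_poisson,
    ENNReal.toReal_inv, ← measureReal_def, Complex.real_smul, Complex.ofReal_inv, hmass]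
  have h1 : (∏ i, Complex.exp (-(lam i : ℝ))) ≠ 0 :=
    Finset.prod_ne_zero_iff.2 fun i _ => Complex.exp_ne_zero _
  have h2 : (∏ h, ((tot h : ℂ) ^ tot h / (tot h).factorial)) ≠ 0 :=
    Finset.prod_ne_zero_iff.2 fun h _ => div_ne_zero (pow_ne_zero _ (htot0 h))
      (by exact_mod_cast (tot h).factorial_ne_zero)
  rw [mul_inv, mul_mul_mul_comm, inv_mul_cancel₀ h1, one_mul, inv_mul_eq_div,
    ← Finset.prod_div_distrib]
  refine Finset.prod_congr rfl fun h _ => ?_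
  have h3 : ((tot h).factorial : ℂ) ≠ 0 := by exact_mod_cast (tot h).factorial_ne_zero
  rw [div_div_div_cancel_right₀ h3, div_pow]

theorem integral_prod_pow_poisson (lam : Fin k → NNReal) (z : Fin k → ℂ) :
    ∫ n, ∏ i, z i ^ n i ∂(Measure.pi fun i => poissonMeasure (lam i)) =
      ∏ i, Complex.exp ((lam i : ℝ) * (z i - 1)) := by
  rw [integral_fintype_prod_eq_prod (fun i (j : ℕ) => z i ^ j)]
  refine Finset.prod_congr rfl fun i _ => ?_
  rw [integral_poissonMeasure]
  have hterm : ∀ j : ℕ, (Real.exp (-(lam i : ℝ)) * (lam i : ℝ) ^ j / j.factorial) • z i ^ j =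
      Complex.exp (-(lam i : ℝ)) * (((lam i : ℝ) * z i) ^ j / j.factorial) := by
    intro j
    rw [Complex.real_smul]
    push_cast
    rw [mul_pow]
    ring
  rw [tsum_congr hterm, tsum_mul_left,
    (NormedSpace.expSeries_div_hasSum_exp (((lam i : ℝ) : ℂ) * z i)).tsum_eq,
    ← Complex.exp_eq_exp_ℂ, ← Complex.exp_add]
  congr 1
  ring

end GeneratingFunction
end

/-! ### Limits of characteristic functions -/

noncomputable section

open Asymptotics

theorem tendsto_one_add_div_pow_natCast {α : Type*} {l : Filter α} {T : α → ℕ} {E : α → ℂ} {e : ℂ}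
    (hT : Tendsto T l atTop) (hE : Tendsto E l (𝓝 e)) :
    Tendsto (fun a => (1 + E a / T a) ^ T a) l (𝓝 (Complex.exp e)) := by
  have hinv : Tendsto (fun a => ((T a : ℂ))⁻¹) l (𝓝 0) :=
    (tendsto_inv_atTop_nhds_zero_nat (𝕜 := ℂ)).comp hT
  have hy : Tendsto (fun a => E a / T a) l (𝓝 0) := by
    simpa [div_eq_mul_inv] using hE.mul hinv
  have hT0 : ∀ᶠ a in l, (T a : ℂ) ≠ 0 :=
    (hT.eventually_ge_atTop 1).mono fun a ha => by exact_mod_cast (by omega : T a ≠ 0)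
  have hlog : Tendsto (fun a => (T a : ℂ) * Complex.log (1 + E a / T a)) l (𝓝 e) := by
    have h1 : (fun a => (T a : ℂ) * (Complex.log (1 + E a / T a) - E a / T a)) =O[l]
        fun a => (T a : ℂ) * (E a / T a) ^ 2 :=
      (isBigO_refl _ _).mul (Complex.log_sub_self_isBigO.comp_tendsto hy)
    have h2 : Tendsto (fun a => (T a : ℂ) * (E a / T a) ^ 2) l (𝓝 0) := by
      have h3 : Tendsto (fun a => E a * (E a / T a)) l (𝓝 0) := by simpa using hE.mul hy
      refine h3.congr' (hT0.mono fun a ha => ?_)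
      field_simp
    have h4 := (h1.trans_tendsto h2).add hE
    rw [zero_add] at h4
    refine h4.congr' (hT0.mono fun a ha => ?_)
    field_simp
    ring
  refine ((Complex.continuous_exp.tendsto e).comp hlog).congr' ?_
  have hne : ∀ᶠ a in l, 1 + E a / T a ≠ 0 := by
    have := hy.const_add 1
    rw [add_zero] at this
    exact this.eventually_ne one_ne_zero
  filter_upwards [hne] with a ha
  rw [Function.comp_apply, Complex.exp_nat_mul, Complex.exp_log ha]

/-- For `y = i t / √λ` the quadratic Taylor term contributes `λ y ^ 2 / 2 = -t ^ 2 / 2` exactly, and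
the remainder is of order `λ |y| ^ 3 = t ^ 2 |y| → 0`. The linear term, which diverges, is removed
by the centring under Poisson sampling and by the choice of `t` otherwise. -/
theorem tendsto_mul_exp_sub_one_sub {α : Type*} {l : Filter α} {lam : α → ℝ}
    (hlam : Tendsto lam l atTop) (t : ℝ) :
    Tendsto (fun a => (lam a : ℂ) * (Complex.exp ((t / √(lam a) : ℝ) * Complex.I) - 1 -
      (t / √(lam a) : ℝ) * Complex.I)) l (𝓝 (-(t : ℂ) ^ 2 / 2)) := by
  set y : α → ℂ := fun a => (t / √(lam a) : ℝ) * Complex.I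
  have hy : Tendsto y l (𝓝 0) := by
    have h1 : Tendsto (fun a => t / √(lam a)) l (𝓝 0) :=
      (Real.tendsto_sqrt_atTop.comp hlam).const_div_atTop t
    have h2 := ((Complex.continuous_ofReal.tendsto 0).comp h1).mul_const Complex.I
    simpa [y, Function.comp_def] using h2
  have hsq : ∀ᶠ a in l, (lam a : ℂ) * y a ^ 2 = -(t : ℂ) ^ 2 := by
    filter_upwards [hlam.eventually_gt_atTop 0] with a ha
    have h1 : lam a * (t / √(lam a)) ^ 2 = t ^ 2 := by
      rw [div_pow, Real.sq_sqrt ha.le]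
      field_simp
    have h2 : (lam a : ℂ) * ((t / √(lam a) : ℝ) : ℂ) ^ 2 = (t : ℂ) ^ 2 := by exact_mod_cast h1
    simp only [y, mul_pow, Complex.I_sq]
    linear_combination -h2
  have hO := (isBigO_refl (fun a => (lam a : ℂ)) l).mul
    ((Complex.exp_sub_sum_range_isBigO_pow 3).comp_tendsto hy)
  have h3 : Tendsto (fun a => (lam a : ℂ) * ((fun x : ℂ => x ^ 3) ∘ y) a) l (𝓝 0) := by
    have := hy.const_mul (-(t : ℂ) ^ 2)
    rw [mul_zero] at this
    refine this.congr' (hsq.mono fun a ha => ?_)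
    rw [← ha]
    simp only [Function.comp_apply]
    ring
  have h4 := (hO.trans_tendsto h3).add_const (-(t : ℂ) ^ 2 / 2)
  rw [zero_add] at h4
  refine h4.congr' (hsq.mono fun a ha => ?_)
  change _ = (lam a : ℂ) * (Complex.exp (y a) - 1 - y a)
  rw [← ha]
  simp [Finset.sum_range_succ]
  ring

variable {k c : ℕ}

/-- The first factor comes from the centring; the integral is the generating function at `z i = exp
(i t i / √(lam i))`. -/
theorem charFun_map_standardize (μ : Measure (Fin k → ℕ)) {lam : Fin k → ℝ} (hlam : ∀ i, 0 < lam i)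
    (t : EuclideanSpace ℝ (Fin k)) :
    charFun (μ.map fun n => standardize lam fun i => (n i : ℝ)) t =
      (∏ i, Complex.exp (-((lam i : ℂ) * ((t i / √(lam i) : ℝ) * Complex.I)))) *
        ∫ n, ∏ i, Complex.exp ((t i / √(lam i) : ℝ) * Complex.I) ^ n i ∂μ := by
  rw [charFun_apply, integral_map (Measurable.of_discrete).aemeasurable
    (by fun_prop), ← integral_const_mul]
  refine integral_congr_ae (Eventually.of_forall fun n => ?_)
  simp only [← Complex.exp_nat_mul, ← Complex.exp_add, ← Complex.exp_sum,
    ← Finset.sum_add_distrib]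
  congr 1
  simp only [PiLp.inner_apply, standardize, RCLike.inner_apply, conj_trivial, Complex.ofReal_sum,
    Finset.sum_mul]
  refine Finset.sum_congr rfl fun i _ => ?_
  have h := (Real.sqrt_pos.2 (hlam i)).ne'
  push_cast
  ring

theorem transpose_mulVec_eq_sum {s : Fin k → Fin c} {X₀ : Matrix (Fin k) (Fin c) ℝ}
    (hX : X₀ = Matrix.of fun i h => if s i = h then 1 else 0) (v : Fin k → ℝ) (h : Fin c) :
    (X₀ᵀ *ᵥ v) h = ∑ i ∈ Finset.univ.filter (fun i => s i = h), v i := by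
  subst hX
  simp [Matrix.mulVec, dotProduct, Finset.sum_filter]

/-- Convergence of the characteristic functions of the standardized tables, in the directions
orthogonal to the prefixed totals. -/
theorem tendsto_charFun_standardize {X₀ : Matrix (Fin k) (Fin c) ℝ} (hX₀ : IsSamplingMatrix X₀)
    {tot : ℕ → Fin c → ℕ} {N : ℕ → ℝ} (hN : Tendsto N atTop atTop) (hNpos : ∀ ν, 0 < N ν)
    {m : Fin k → ℝ} (hm : ∀ i, 0 < m i)
    (htot : ∀ ν, X₀ᵀ *ᵥ (N ν • m) = fun h => (tot ν h : ℝ)) {t : EuclideanSpace ℝ (Fin k)}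
    (ht : constraintMap m X₀ t = 0) :
    Tendsto (fun ν => charFun ((samplingLaw X₀ (tot ν) (N ν • m)).map
      fun n => standardize (N ν • m) fun i => (n i : ℝ)) t) atTop
      (𝓝 (Complex.exp (-‖t‖ ^ 2 / 2))) := by
  have hlam : ∀ ν i, 0 < (N ν • m) i := fun ν i => mul_pos (hNpos ν) (hm i)
  have hcoe : ∀ ν i, (((N ν • m) i).toNNReal : ℝ) = (N ν • m) i :=
    fun ν i => Real.coe_toNNReal _ (hlam ν i).le
  have hlim : ∀ i, Tendsto (fun ν => (N ν • m) i) atTop atTop := fun i =>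
    hN.atTop_mul_const (hm i)
  set u : ℕ → Fin k → ℂ := fun ν i => (t i / √((N ν • m) i) : ℝ) * Complex.I
  have he : ∀ i, Tendsto (fun ν => (((N ν • m) i : ℝ) : ℂ) * (Complex.exp (u ν i) - 1 - u ν i))
      atTop (𝓝 (-(t i : ℂ) ^ 2 / 2)) := fun i => tendsto_mul_exp_sub_one_sub (hlim i) (t i)
  have hnorm : (-(‖t‖ : ℂ) ^ 2 / 2) = ∑ i, (-(t i : ℂ) ^ 2 / 2) := by
    have := EuclideanSpace.norm_sq_eq t
    simp only [Real.norm_eq_abs, sq_abs] at this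
    rw [← Finset.sum_div, Finset.sum_neg_distrib]
    exact_mod_cast congrArg (fun x : ℝ => ((-x / 2 : ℝ) : ℂ)) this
  rw [hnorm]
  simp_rw [charFun_map_standardize _ (hlam _)]
  rcases hX₀ with rfl | ⟨s, hs, hX⟩
  · have hlaw : ∀ ν, samplingLaw X₀ (tot ν) (N ν • m) =
        Measure.pi fun i => poissonMeasure ((N ν • m) i).toNNReal := by
      intro ν
      rw [samplingLaw]
      convert ProbabilityTheory.cond_univ _
      · exact Set.eq_univ_of_forall fun n => Subsingleton.elim _ _
      · infer_instance
    refine ((Complex.continuous_exp.tendsto _).comp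
      (tendsto_finsetSum Finset.univ fun i _ => he i)).congr fun ν => ?_
    rw [hlaw, integral_prod_pow_poisson, ← Finset.prod_mul_distrib, Function.comp_apply,
      Complex.exp_sum]
    refine Finset.prod_congr rfl fun i _ => ?_
    rw [← Complex.exp_add, hcoe]
    congr 1
    simp only [u]
    ring
  · have htot' : ∀ ν h, ∑ i ∈ Finset.univ.filter (fun i => s i = h), (N ν • m) i = tot ν h := by
      intro ν h
      rw [← transpose_mulVec_eq_sum hX, htot]
    have hset : ∀ ν, {n : Fin k → ℕ | X₀ᵀ *ᵥ (fun i => (n i : ℝ)) = fun h => (tot ν h : ℝ)} =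
        (tablesWithTotals s (tot ν) : Set (Fin k → ℕ)) := by
      intro ν
      ext n
      rw [Finset.mem_coe, mem_tablesWithTotals]
      change X₀ᵀ *ᵥ (fun i => (n i : ℝ)) = _ ↔ _
      rw [funext_iff]
      refine forall_congr' fun h => ?_
      rw [transpose_mulVec_eq_sum hX]
      exact_mod_cast Iff.rfl
    -- Each subtable contains a cell, and its total is at least the mean of that cell, which tends
    -- to infinity.
    have hTlim : ∀ h, Tendsto (fun ν => tot ν h) atTop atTop := by
      intro h
      obtain ⟨i, hi⟩ := hs h
      rw [← tendsto_natCast_atTop_iff (R := ℝ)]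
      refine tendsto_atTop_mono (fun ν => ?_) (hlim i)
      rw [← htot' ν h]
      exact Finset.single_le_sum (f := fun i => (N ν • m) i) (fun j _ => (hlam ν j).le)
        (by simp [hi])
    -- Orthogonality of `t` to the prefixed totals kills the first order terms within each subtable.
    -- Both the centring factor and the linear part of the generating function therefore disappear.
    have hu : ∀ ν h, ∑ i ∈ Finset.univ.filter (fun i => s i = h),
        (((N ν • m) i : ℝ) : ℂ) * u ν i = 0 := by
      intro ν h
      have h1 := congrFun ht h
      rw [constraintMap_apply, transpose_mulVec_eq_sum hX] at h1
      have h2 : ∀ i, (N ν • m) i * (t i / √((N ν • m) i)) = √(N ν) * (√(m i) * t i) := by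
        intro i
        have h3 := (Real.sqrt_pos.2 (hlam ν i)).ne'
        have h4 : √((N ν • m) i) = √(N ν) * √(m i) := Real.sqrt_mul (hNpos ν).le _
        rw [← mul_assoc, ← h4, mul_div_assoc', div_eq_iff h3]
        linear_combination (-(t i)) * Real.mul_self_sqrt (hlam ν i).le
      have h5 : ∑ i ∈ Finset.univ.filter (fun i => s i = h),
          (N ν • m) i * (t i / √((N ν • m) i)) = 0 := by
        rw [Finset.sum_congr rfl fun i _ => h2 i, ← Finset.mul_sum, h1]
        simp
      have h6 := congrArg (fun x : ℝ => (x : ℂ) * Complex.I) h5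
      simp only [Complex.ofReal_sum, Finset.sum_mul, Complex.ofReal_zero, zero_mul] at h6
      rw [← h6]
      refine Finset.sum_congr rfl fun i _ => ?_
      simp only [u]
      push_cast
      ring
    have hexp : ∀ h, Tendsto (fun ν => (1 + (∑ i ∈ Finset.univ.filter (fun i => s i = h),
        (((N ν • m) i : ℝ) : ℂ) * (Complex.exp (u ν i) - 1 - u ν i)) / tot ν h) ^ tot ν h)
        atTop (𝓝 (Complex.exp (∑ i ∈ Finset.univ.filter (fun i => s i = h),
          (-(t i : ℂ) ^ 2 / 2)))) := fun h =>
      tendsto_one_add_div_pow_natCast (hTlim h) (tendsto_finsetSum _ fun i _ => he i)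
    have hprod := tendsto_finsetProd Finset.univ fun h (_ : h ∈ Finset.univ) => hexp h
    rw [← Complex.exp_sum, Finset.sum_fiberwise] at hprod
    refine hprod.congr' ?_
    have hT0 : ∀ᶠ ν in atTop, ∀ h, 1 ≤ tot ν h :=
      eventually_all.2 fun h => (hTlim h).eventually_ge_atTop 1
    filter_upwards [hT0] with ν hν
    rw [samplingLaw, hset, integral_prod_pow_cond_poisson hs
      (fun i => Real.toNNReal_pos.2 (hlam ν i)) (by simpa only [hcoe] using htot' ν),
      ← Complex.exp_sum, ← Finset.sum_fiberwise Finset.univ s]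
    simp only [hcoe]
    have h0 : ∑ h, ∑ i ∈ Finset.univ.filter (fun i => s i = h),
        -((((N ν • m) i : ℝ) : ℂ) * ((t i / √((N ν • m) i) : ℝ) * Complex.I)) = 0 := by
      refine Finset.sum_eq_zero fun h _ => ?_
      rw [Finset.sum_neg_distrib, neg_eq_zero]
      exact hu ν h
    rw [h0, Complex.exp_zero, one_mul]
    refine Finset.prod_congr rfl fun h _ => ?_
    have hT : (tot ν h : ℂ) ≠ 0 := by exact_mod_cast (by have := hν h; omega : tot ν h ≠ 0)
    have hsum : ∑ i ∈ Finset.univ.filter (fun i => s i = h), (((N ν • m) i : ℝ) : ℂ) = tot ν h := by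
      exact_mod_cast congrArg (fun x : ℝ => (x : ℂ)) (htot' ν h)
    congr 1
    rw [eq_div_iff hT, add_mul, div_mul_cancel₀ _ hT, one_mul]
    simp only [mul_sub, Finset.sum_sub_distrib, hu, mul_one, hsum]
    simp only [u]
    ring
end

/-! ### Independence under the standard Gaussian measure -/

noncomputable section

section Gaussian

variable {E : Type*} [NormedAddCommGroup E] [InnerProductSpace ℝ E] [FiniteDimensional ℝ E]
  [MeasurableSpace E] [BorelSpace E]

theorem charFun_map_starProjection (K : Submodule ℝ E) (μ : Measure E) (t : E) :
    charFun (μ.map K.starProjection) t = charFun μ (K.starProjection t) := by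
  rw [charFun_apply, charFun_apply, integral_map (by fun_prop) (by fun_prop)]
  simp_rw [Submodule.inner_starProjection_left_eq_right]

/-- Two symmetric operators with vanishing product are independent under the standard Gaussian
measure. -/
theorem map_prodMk_stdGaussian {A B : E →L[ℝ] E} (hA : (A : E →ₗ[ℝ] E).IsSymmetric)
    (hB : (B : E →ₗ[ℝ] E).IsSymmetric) (hAB : A.comp B = 0) :
    (stdGaussian E).map (fun x => (A x, B x)) =
      ((stdGaussian E).map A).prod ((stdGaussian E).map B) := by
  have hAp : IsProbabilityMeasure ((stdGaussian E).map A) :=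
    Measure.isProbabilityMeasure_map (by fun_prop)
  have hBp : IsProbabilityMeasure ((stdGaussian E).map B) :=
    Measure.isProbabilityMeasure_map (by fun_prop)
  have hABp : IsProbabilityMeasure ((stdGaussian E).map fun x => (A x, B x)) :=
    Measure.isProbabilityMeasure_map (by fun_prop)
  have hsymm : ∀ {C : E →L[ℝ] E}, (C : E →ₗ[ℝ] E).IsSymmetric → ∀ t,
      charFun ((stdGaussian E).map C) t = Complex.exp (-‖C t‖ ^ 2 / 2) := by
    intro C hC t
    rw [← charFun_stdGaussian, charFun_apply, charFun_apply,
      integral_map (by fun_prop) (by fun_prop)]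
    refine integral_congr_ae (Eventually.of_forall fun x => ?_)
    have : inner ℝ (C x) t = inner ℝ x (C t) := hC x t
    simp only [this]
  refine charFun_eq_prod_iff.1 fun t => ?_
  rw [hsymm hA, hsymm hB, ← Complex.exp_add, Measure.map_map (by fun_prop) (by fun_prop),
    charFun_apply, integral_map (by fun_prop) (by fun_prop)]
  have hsum : ∀ x, inner ℝ (WithLp.toLp 2 (A x, B x)) t =
      inner ℝ x (A (WithLp.ofLp t).1 + B (WithLp.ofLp t).2) := by
    intro x
    have h1 : inner ℝ (A x) (WithLp.ofLp t).1 = inner ℝ x (A (WithLp.ofLp t).1) := hA _ _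
    have h2 : inner ℝ (B x) (WithLp.ofLp t).2 = inner ℝ x (B (WithLp.ofLp t).2) := hB _ _
    rw [inner_add_right, ← h1, ← h2]
    rfl
  -- Symmetry moves `A` across, where it meets `B` and the product vanishes. By Pythagoras the joint
  -- characteristic function then factors.
  have horth : inner ℝ (A (WithLp.ofLp t).1) (B (WithLp.ofLp t).2) = 0 := by
    have h1 : inner ℝ (A (WithLp.ofLp t).1) (B (WithLp.ofLp t).2) =
      inner ℝ (WithLp.ofLp t).1 (A (B (WithLp.ofLp t).2)) := hA _ _
    have h2 : A (B (WithLp.ofLp t).2) = 0 := DFunLike.congr_fun hAB _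
    rw [h1, h2, inner_zero_right]
  have hpyth := norm_add_sq_eq_norm_sq_add_norm_sq_of_inner_eq_zero _ _ horth
  simp only [Function.comp_apply, hsum]
  rw [← charFun_apply, charFun_stdGaussian]
  congr 1
  have h3 := congrArg (fun x : ℝ => (x : ℂ)) hpyth
  push_cast at h3
  linear_combination (-1 / 2) * h3

end Gaussian

/-! ### Central limit theorem for tables and transfer to the statistics -/

section SamplingLaw

variable {k c : ℕ} {X₀ : Matrix (Fin k) (Fin c) ℝ}

theorem standardize_smul {N : ℝ} (hN : 0 < N) (m p : Fin k → ℝ) :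
    standardize (N • m) (N • p) = √N • standardize m p := by
  ext i
  have h1 : √((N • m) i) = √N * √(m i) := Real.sqrt_mul hN.le _
  have h2 := (Real.sqrt_pos.2 hN).ne'
  simp only [standardize, PiLp.smul_apply, smul_eq_mul, h1]
  simp only [Pi.smul_apply, smul_eq_mul, ← mul_sub]
  nth_rewrite 1 [← Real.mul_self_sqrt hN.le]
  rw [mul_assoc, mul_div_mul_left _ _ h2, mul_div_assoc]

/-- Conditioning fixes the subtable totals at their means, so the standardized table almost surely
lies in the kernel of the sampling constraints. -/
theorem ae_constraintMap_standardize_eq_zero {tot : Fin c → ℕ} {N : ℝ} (hN : 0 < N)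
    {m : Fin k → ℝ} (hm : ∀ i, 0 < m i) (htot : X₀ᵀ *ᵥ (N • m) = fun h => (tot h : ℝ)) :
    ∀ᵐ n ∂(samplingLaw X₀ tot (N • m)),
      constraintMap m X₀ (standardize (N • m) fun i => ((n i : ℕ) : ℝ)) = 0 := by
  have hmem := ae_cond_mem (μ := Measure.pi fun i => poissonMeasure ((N • m) i).toNNReal)
    (s := {n : Fin k → ℕ | X₀ᵀ *ᵥ (fun i => (n i : ℝ)) = fun h => (tot h : ℝ)})
    (MeasurableSet.of_discrete)
  filter_upwards [hmem] with n hn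
  have hn' : X₀ᵀ *ᵥ (fun i => (n i : ℝ)) = fun h => (tot h : ℝ) := hn
  have h1 : (fun i => (n i : ℝ)) = N • (N⁻¹ • fun i => (n i : ℝ)) := by
    rw [smul_smul, mul_inv_cancel₀ hN.ne', one_smul]
  have h2 : X₀ᵀ *ᵥ (N⁻¹ • fun i => (n i : ℝ)) = X₀ᵀ *ᵥ m := by
    rw [Matrix.mulVec_smul, hn', ← htot, Matrix.mulVec_smul, smul_smul, inv_mul_cancel₀ hN.ne',
      one_smul]
  rw [h1, standardize_smul hN, map_smul, constraintMap_standardize hm, h2, sub_self, smul_zero]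

/-- The central limit theorem for tables, in terms of characteristic functions. -/
theorem tendsto_charFun_samplingLaw (hX₀ : IsSamplingMatrix X₀)
    {tot : ℕ → Fin c → ℕ} {N : ℕ → ℝ} (hN : Tendsto N atTop atTop) (hNpos : ∀ ν, 0 < N ν)
    {m : Fin k → ℝ} (hm : ∀ i, 0 < m i)
    (htot : ∀ ν, X₀ᵀ *ᵥ (N ν • m) = fun h => (tot ν h : ℝ)) (t : EuclideanSpace ℝ (Fin k)) :
    Tendsto (fun ν => charFun ((samplingLaw X₀ (tot ν) (N ν • m)).map
      fun n => standardize (N ν • m) fun i => (n i : ℝ)) t) atTop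
      (𝓝 (charFun ((stdGaussian (EuclideanSpace ℝ (Fin k))).map
        (LinearMap.ker (constraintMap m X₀)).starProjection) t)) := by
  set K := LinearMap.ker (constraintMap m X₀)
  rw [charFun_map_starProjection, charFun_stdGaussian]
  have ht : constraintMap m X₀ (K.starProjection t) = 0 :=
    LinearMap.mem_ker.1 (Submodule.starProjection_apply_mem K t)
  -- Since the table lies in `K` almost surely, its characteristic function at `t` equals that at
  -- the projection of `t` to `K`, for which convergence is known.
  refine (tendsto_charFun_standardize hX₀ hN hNpos hm htot ht).congr fun ν => ?_
  rw [charFun_apply, charFun_apply, integral_map (Measurable.of_discrete).aemeasurable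
    (by fun_prop), integral_map (Measurable.of_discrete).aemeasurable (by fun_prop)]
  refine integral_congr_ae ?_
  filter_upwards [ae_constraintMap_standardize_eq_zero (hNpos ν) hm (htot ν)] with n hn
  rw [← Submodule.inner_starProjection_left_eq_right,
    Submodule.starProjection_eq_self_iff.2 (LinearMap.mem_ker.2 hn)]

/-- Statistics approximated by squared norms of symmetric operators with vanishing product applied
to the standardized table are asymptotically independent. -/
theorem asymptoticallyIndependent_of_approx (hX₀ : IsSamplingMatrix X₀)
    {tot : ℕ → Fin c → ℕ} {N : ℕ → ℝ} (hN : Tendsto N atTop atTop) (hNpos : ∀ ν, 0 < N ν)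
    {m : Fin k → ℝ} (hm : ∀ i, 0 < m i)
    (htot : ∀ ν, X₀ᵀ *ᵥ (N ν • m) = fun h => (tot ν h : ℝ))
    {A B : EuclideanSpace ℝ (Fin k) →L[ℝ] EuclideanSpace ℝ (Fin k)}
    (hA : (A : EuclideanSpace ℝ (Fin k) →ₗ[ℝ] EuclideanSpace ℝ (Fin k)).IsSymmetric)
    (hB : (B : EuclideanSpace ℝ (Fin k) →ₗ[ℝ] EuclideanSpace ℝ (Fin k)).IsSymmetric)
    (hAB : A.comp B = 0)
    (hAK : ∀ x, A ((LinearMap.ker (constraintMap m X₀)).starProjection x) = A x)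
    (hBK : ∀ x, B ((LinearMap.ker (constraintMap m X₀)).starProjection x) = B x)
    {S T : ℕ → (Fin k → ℕ) → ℝ}
    (hS : ∀ ε, 0 < ε → ∀ K, ∀ᶠ ν in atTop, ∀ n : Fin k → ℕ,
      ‖standardize (N ν • m) fun i => (n i : ℝ)‖ ≤ K →
      |S ν n - ‖A (standardize (N ν • m) fun i => (n i : ℝ))‖ ^ 2| ≤ ε)
    (hT : ∀ ε, 0 < ε → ∀ K, ∀ᶠ ν in atTop, ∀ n : Fin k → ℕ,
      ‖standardize (N ν • m) fun i => (n i : ℝ)‖ ≤ K →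
      |T ν n - ‖B (standardize (N ν • m) fun i => (n i : ℝ))‖ ^ 2| ≤ ε)
    {Ω : ℕ → Type*} [∀ ν, MeasurableSpace (Ω ν)] (P : ∀ ν, Measure (Ω ν))
    [∀ ν, IsProbabilityMeasure (P ν)] (n : ∀ ν, Ω ν → Fin k → ℕ)
    (hn : ∀ ν, HasLaw (n ν) (samplingLaw X₀ (tot ν) (N ν • m)) (P ν)) :
    AsymptoticallyIndependent P (fun ν ω => S ν (n ν ω)) (fun ν ω => T ν (n ν ω)) := by
  set K₀ := LinearMap.ker (constraintMap m X₀)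
  set γ := stdGaussian (EuclideanSpace ℝ (Fin k))
  let ρ : ℕ → Measure (Fin k → ℕ) := fun ν => samplingLaw X₀ (tot ν) (N ν • m)
  have hρ : ∀ ν, IsProbabilityMeasure (samplingLaw X₀ (tot ν) (N ν • m)) := fun ν => by
    rw [← (hn ν).map_eq]
    exact Measure.isProbabilityMeasure_map (hn ν).aemeasurable
  -- Convergence in measure requires all tables on one probability space. Only their individual laws
  -- matter for the conclusion, so an independent coupling serves.
  let Q : Measure (ℕ → Fin k → ℕ) := Measure.infinitePi ρ
  let w : ℕ → (Fin k → ℕ) → EuclideanSpace ℝ (Fin k) :=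
    fun ν n => standardize (N ν • m) fun i => (n i : ℝ)
  have hQmap : ∀ {F : Type} [MeasurableSpace F] (ν : ℕ) (f : (Fin k → ℕ) → F),
      Q.map (fun ω => f (ω ν)) = (ρ ν).map f := by
    intro F _ ν f
    have h := Measure.map_map (μ := Q) (Measurable.of_discrete (f := f)) (measurable_pi_apply ν)
    rw [Measure.infinitePi_map_eval ρ ν] at h
    exact h.symm
  have hmeas : ∀ {F : Type} [MeasurableSpace F] (ν : ℕ) (f : (Fin k → ℕ) → F),
      Measurable fun ω : ℕ → Fin k → ℕ => f (ω ν) := fun ν f =>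
    (Measurable.of_discrete (f := f)).comp (measurable_pi_apply ν)
  have hlawp : ∀ ν, IsProbabilityMeasure ((ρ ν).map (w ν)) := fun ν =>
    Measure.isProbabilityMeasure_map (Measurable.of_discrete).aemeasurable
  have hchar := tendsto_charFun_samplingLaw hX₀ hN hNpos hm htot
  have hW : TendstoInDistribution (fun ν ω => w ν (ω ν)) atTop K₀.starProjection
      (fun _ => Q) γ := by
    refine ⟨fun ν => (hmeas ν (w ν)).aemeasurable, by fun_prop, ?_⟩
    refine ProbabilityMeasure.tendsto_of_tendsto_charFun fun t => ?_
    simp only [ProbabilityMeasure.coe_mk, hQmap]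
    exact hchar t
  have htight : IsTightMeasureSet (Set.range fun ν => (ρ ν).map (w ν)) := by
    refine isTightMeasureSet_of_tendsto_charFun (f := charFun (γ.map K₀.starProjection)) ?_ hchar
    have : IsProbabilityMeasure (γ.map K₀.starProjection) :=
      Measure.isProbabilityMeasure_map (by fun_prop)
    fun_prop
  let g : EuclideanSpace ℝ (Fin k) → ℝ × ℝ := fun x => (‖A x‖ ^ 2, ‖B x‖ ^ 2)
  have hg : Continuous g := by fun_prop
  have hdiff : TendstoInMeasure Q
      ((fun ν ω => (S ν (ω ν), T ν (ω ν))) - fun ν => g ∘ fun ω => w ν (ω ν)) atTop 0 := by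
    rw [tendstoInMeasure_iff_norm]
    intro ε hε
    rw [ENNReal.tendsto_nhds_zero]
    intro δ hδ
    -- Tightness confines the standardized table to a compact set up to mass `δ`, and on bounded
    -- sets the approximations of `S` and `T` are uniform.
    obtain ⟨K, hK, hKδ⟩ := isTightMeasureSet_iff_exists_isCompact_measure_compl_le.1 htight δ hδ
    obtain ⟨R, hR⟩ := hK.isBounded.exists_norm_le
    filter_upwards [hS (ε / 2) (by positivity) R, hT (ε / 2) (by positivity) R] with ν hSν hTν
    refine le_trans (measure_mono (t := (fun ω => w ν (ω ν)) ⁻¹' Kᶜ) ?_) ?_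
    · intro ω hω hωK
      have h1 := hSν (ω ν) (hR _ hωK)
      have h2 := hTν (ω ν) (hR _ hωK)
      have h3 : ε ≤ ‖((S ν (ω ν), T ν (ω ν)) : ℝ × ℝ) - g (w ν (ω ν))‖ := by simpa using hω
      have h4 : ‖((S ν (ω ν), T ν (ω ν)) : ℝ × ℝ) - g (w ν (ω ν))‖ ≤ ε / 2 := by
        rw [Prod.norm_def]
        exact max_le h1 h2
      linarith
    · rw [← Measure.map_apply (hmeas ν (w ν)) hK.measurableSet.compl, hQmap]
      exact hKδ _ ⟨ν, rfl⟩
  have hY := tendstoInDistribution_of_tendstoInMeasure_sub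
    (fun ν (ω : ℕ → Fin k → ℕ) => (S ν (ω ν), T ν (ω ν))) (g ∘ K₀.starProjection)
    (hW.continuous_comp hg) hdiff (fun ν => (hmeas ν fun n => (S ν n, T ν n)).aemeasurable)
  let μ₁ : Measure ℝ := (γ.map A).map fun x => ‖x‖ ^ 2
  let μ₂ : Measure ℝ := (γ.map B).map fun x => ‖x‖ ^ 2
  have hAp : IsProbabilityMeasure (γ.map A) := Measure.isProbabilityMeasure_map (by fun_prop)
  have hBp : IsProbabilityMeasure (γ.map B) := Measure.isProbabilityMeasure_map (by fun_prop)
  have hμ₁ : IsProbabilityMeasure μ₁ := Measure.isProbabilityMeasure_map (by fun_prop)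
  have hμ₂ : IsProbabilityMeasure μ₂ := Measure.isProbabilityMeasure_map (by fun_prop)
  have hlimit : γ.map (g ∘ K₀.starProjection) = μ₁.prod μ₂ := by
    have hcomp : g ∘ K₀.starProjection = g := by
      funext x
      simp only [g, Function.comp_apply, hAK, hBK]
    rw [hcomp, Measure.map_prod_map _ _ (by fun_prop) (by fun_prop),
      ← map_prodMk_stdGaussian hA hB hAB, Measure.map_map (by fun_prop) (by fun_prop)]
    rfl
  refine ⟨μ₁, μ₂, hμ₁, hμ₂, fun ν => ?_, by fun_prop, ?_⟩
  · exact (Measurable.of_discrete (f := fun n => (S ν n, T ν n))).comp_aemeasurable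
      (hn ν).aemeasurable
  · have hPmap : ∀ ν, (P ν).map (fun ω => (S ν (n ν ω), T ν (n ν ω))) =
        Q.map (fun ω => (S ν (ω ν), T ν (ω ν))) := by
      intro ν
      rw [hQmap ν fun n => (S ν n, T ν n)]
      change _ = (samplingLaw X₀ (tot ν) (N ν • m)).map _
      rw [← (hn ν).map_eq, AEMeasurable.map_map_of_aemeasurable
        Measurable.of_discrete.aemeasurable (hn ν).aemeasurable]
      rfl
    have hlim := hY.tendsto
    simp only [hPmap, Measure.map_id, ← hlimit]
    exact hlim

end SamplingLaw
end

/-! ### Inheritance of regularity and nested projections -/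

noncomputable section

section Regularity

variable {k : ℕ} {κ κ' : Type*} {m : Fin k → ℝ} {V V' : Submodule ℝ (Fin k → ℝ)}
  {L : Matrix (Fin k) κ ℝ} {L' : Matrix (Fin k) κ' ℝ}

theorem surjective_mulVec_of_rank_eq_card {ι : Type*} [Fintype ι] [Fintype κ]
    {A : Matrix ι κ ℝ} (hA : A.rank = Fintype.card κ) :
    Function.Surjective fun v => Aᵀ *ᵥ v := by
  have h : LinearMap.range Aᵀ.mulVecLin = ⊤ := by
    refine Submodule.eq_top_of_finrank_eq ?_
    rw [Module.finrank_fintype_fun_eq_card, ← hA, ← Matrix.rank_transpose]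
    rfl
  exact LinearMap.range_eq_top.1 h

theorem surjective_logConstraintMap_of_rank {t : ℕ} {X : Matrix (Fin k) (Fin t) ℝ} [Fintype κ]
    (h : (Xᵀ * Matrix.diagonal m * L).rank = Fintype.card κ) :
    Function.Surjective
      (logConstraintMap m (Submodule.span ℝ (Set.range X.col)) L) := by
  intro y
  obtain ⟨v, hv⟩ := surjective_mulVec_of_rank_eq_card h y
  refine ⟨⟨X *ᵥ v, ?_⟩, ?_⟩
  · rw [← Matrix.range_mulVecLin]
    exact ⟨v, rfl⟩
  · rw [← hv]
    simp [logConstraintMap, Matrix.transpose_mul, ← Matrix.mulVec_mulVec,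
      Matrix.diagonal_transpose, Matrix.mulVec_transpose]

theorem exists_transpose_eq_mul [Fintype κ']
    (h : Submodule.span ℝ (Set.range L.col) ≤ Submodule.span ℝ (Set.range L'.col)) :
    ∃ W : Matrix κ κ' ℝ, Lᵀ = W * L'ᵀ := by
  have hcol : ∀ j, ∃ w : κ' → ℝ, L' *ᵥ w = L.col j := by
    intro j
    have := h (Submodule.subset_span ⟨j, rfl⟩)
    rw [← Matrix.range_mulVecLin] at this
    exact this
  choose w hw using hcol
  refine ⟨Matrix.of w, ?_⟩
  ext j i
  have := congrFun (hw j) i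
  simp only [Matrix.mulVec, dotProduct, Matrix.col_apply] at this
  simp only [Matrix.transpose_apply, Matrix.mul_apply, Matrix.of_apply, ← this]
  exact Finset.sum_congr rfl fun _ _ => mul_comm _ _

/-- Regularity of the constraints is inherited by larger models. -/
theorem surjective_logConstraintMap_mono [Fintype κ] [Fintype κ'] (hV : V' ≤ V)
    (hL : Submodule.span ℝ (Set.range L.col) ≤ Submodule.span ℝ (Set.range L'.col))
    (hrank : L.rank = Fintype.card κ)
    (hreg : Function.Surjective (logConstraintMap m V' L')) :
    Function.Surjective (logConstraintMap m V L) := by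
  obtain ⟨W, hW⟩ := exists_transpose_eq_mul hL
  intro y
  -- Write the target as `Lᵀ x`, solve the finer system with right-hand side `L'ᵀ x`, and multiply
  -- by `W`. The full rank of `L` makes every target reachable.
  obtain ⟨x, hx⟩ := surjective_mulVec_of_rank_eq_card hrank y
  obtain ⟨ξ, hξ⟩ := hreg (L'ᵀ *ᵥ x)
  refine ⟨⟨ξ, hV ξ.2⟩, ?_⟩
  rw [logConstraintMap_apply] at hξ ⊢
  simp only at hx
  rw [← hx, hW, ← Matrix.mulVec_mulVec, ← Matrix.mulVec_mulVec, hξ]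

theorem tangentSpaceAt_mono [Fintype κ'] (hV : V' ≤ V)
    (hL : Submodule.span ℝ (Set.range L.col) ≤ Submodule.span ℝ (Set.range L'.col)) :
    tangentSpaceAt m V' L' ≤ tangentSpaceAt m V L := by
  obtain ⟨W, hW⟩ := exists_transpose_eq_mul hL
  refine inf_le_inf (Submodule.map_mono hV) fun w hw => ?_
  rw [LinearMap.mem_ker, constraintMap_apply] at hw ⊢
  rw [hW, ← Matrix.mulVec_mulVec, hw, Matrix.mulVec_zero]

end Regularity

section DifferenceOfProjections

variable {E : Type*} [NormedAddCommGroup E] [InnerProductSpace ℝ E] [FiniteDimensional ℝ E]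
  {T₁ T₂ T₃ : Submodule ℝ E}

theorem starProjection_starProjection_of_le (h : T₁ ≤ T₂) (x : E) :
    T₁.starProjection (T₂.starProjection x) = T₁.starProjection x := by
  refine ext_inner_right ℝ fun y => ?_
  rw [Submodule.inner_starProjection_left_eq_right, Submodule.inner_starProjection_left_eq_right,
    Submodule.inner_starProjection_left_eq_right,
    Submodule.starProjection_eq_self_iff.2 (h (Submodule.starProjection_apply_mem T₁ y))]

theorem isSymmetric_starProjection_sub (T₁ T₂ : Submodule ℝ E) :
    ((T₁.starProjection - T₂.starProjection : E →L[ℝ] E) : E →ₗ[ℝ] E).IsSymmetric := by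
  intro x y
  change inner ℝ (T₁.starProjection x - T₂.starProjection x) y =
    inner ℝ x (T₁.starProjection y - T₂.starProjection y)
  rw [inner_sub_left, inner_sub_right, Submodule.inner_starProjection_left_eq_right,
    Submodule.inner_starProjection_left_eq_right]

/-- For nested subspaces the product of two projections is the projection to the smaller one, so the
four terms of the expansion cancel in pairs. -/
theorem starProjection_sub_comp_eq_zero (h₁₂ : T₁ ≤ T₂) (h₂₃ : T₂ ≤ T₃) :
    (T₂.starProjection - T₁.starProjection).comp (T₃.starProjection - T₂.starProjection) = 0 := by
  ext x
  have h2 : T₂.starProjection (T₂.starProjection x) = T₂.starProjection x :=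
    starProjection_starProjection_of_le le_rfl x
  simp [starProjection_starProjection_of_le h₂₃, starProjection_starProjection_of_le h₁₂,
    starProjection_starProjection_of_le (h₁₂.trans h₂₃), h2]

end DifferenceOfProjections

/-! ### From models and estimators to normalized mean vectors -/

namespace LMLC

variable {k c : ℕ}

theorem mean_pos (M : LMLC k) (θ : Fin M.t → ℝ) (i : Fin k) : 0 < M.mean θ i := Real.exp_pos _

/-- The column space of `X`. -/
def colSpace (M : LMLC k) : Submodule ℝ (Fin k → ℝ) := Submodule.span ℝ (Set.range M.X.col)

theorem mulVec_mem_colSpace (M : LMLC k) (θ : Fin M.t → ℝ) : M.X *ᵥ θ ∈ M.colSpace := by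
  rw [colSpace, ← Matrix.range_mulVecLin]
  exact ⟨θ, rfl⟩

variable {X₀ : Matrix (Fin k) (Fin c) ℝ} {tot : Fin c → ℕ} {ν : ℕ} {M : LMLC k} {N : ℝ}
  {m : Fin k → ℝ}

theorem transpose_mulVec_eq_d (hnull : N • m ∈ M.model X₀ tot ν) :
    (M.L X₀)ᵀ *ᵥ (N • m) = M.d tot ν := by
  obtain ⟨θ₀, hθ₀, h⟩ := hnull
  rw [← h]
  exact hθ₀

theorem transpose_mulVec_eq_tot (hnull : N • m ∈ M.model X₀ tot ν) :
    X₀ᵀ *ᵥ (N • m) = fun h => (tot h : ℝ) := by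
  funext h
  exact congrFun (transpose_mulVec_eq_d hnull) (Sum.inl h)

/-- The truth is some `mean θ₀`, so the log-ratio is `X (θ - θ₀)`, and both vectors meet the same
linear constraints. Together with `exists_mean_eq_smul`, this identifies the parameter problem at
total `N` with a problem on a set independent of the stage. -/
theorem smul_mean_mem_feasibleSet (hN : 0 < N) (hm : ∀ i, 0 < m i)
    (hnull : N • m ∈ M.model X₀ tot ν) {θ : Fin M.t → ℝ} (hθ : θ ∈ M.paramSpace X₀ tot ν) :
    N⁻¹ • M.mean θ ∈ feasibleSet m M.colSpace (M.L X₀) := by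
  have hd := transpose_mulVec_eq_d hnull
  obtain ⟨θ₀, hθ₀, h₀⟩ := hnull
  refine ⟨fun i => mul_pos (inv_pos.2 hN) (M.mean_pos θ i), ?_, ?_⟩
  · convert! M.mulVec_mem_colSpace (θ - θ₀) using 1
    funext i
    have h1 : (N⁻¹ • M.mean θ) i / m i = M.mean θ i / M.mean θ₀ i := by
      rw [h₀]
      simp only [Pi.smul_apply, smul_eq_mul]
      have := (hm i).ne'
      field_simp
    rw [h1, Real.log_div (M.mean_pos θ i).ne' (M.mean_pos θ₀ i).ne', mean, mean, Real.log_exp,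
      Real.log_exp, Matrix.mulVec_sub, Pi.sub_apply]
  · have h2 : (M.L X₀)ᵀ *ᵥ M.mean θ = M.d tot ν := hθ
    rw [Matrix.mulVec_smul, h2, ← hd, Matrix.mulVec_smul, smul_smul, inv_mul_cancel₀ hN.ne',
      one_smul]

theorem exists_mean_eq_smul (hm : ∀ i, 0 < m i)
    (hnull : N • m ∈ M.model X₀ tot ν) {y : Fin k → ℝ}
    (hy : y ∈ feasibleSet m M.colSpace (M.L X₀)) :
    ∃ θ ∈ M.paramSpace X₀ tot ν, M.mean θ = N • y := by
  have hd := transpose_mulVec_eq_d hnull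
  obtain ⟨θ₀, hθ₀, h₀⟩ := hnull
  obtain ⟨hypos, hlog, hLy⟩ := hy
  rw [colSpace, ← Matrix.range_mulVecLin] at hlog
  obtain ⟨ξ, hξ⟩ := hlog
  have hmean : M.mean (θ₀ + ξ) = N • y := by
    funext i
    have h1 : (M.X *ᵥ ξ) i = Real.log (y i / m i) := congrFun hξ i
    have h2 : Real.exp ((M.X *ᵥ θ₀) i) = N * m i := congrFun h₀ i
    rw [mean, Matrix.mulVec_add, Pi.add_apply, Real.exp_add, h1, h2,
      Real.exp_log (div_pos (hypos i) (hm i)), Pi.smul_apply, smul_eq_mul]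
    have := (hm i).ne'
    field_simp
  refine ⟨θ₀ + ξ, ?_, hmean⟩
  change (M.L X₀)ᵀ *ᵥ M.mean (θ₀ + ξ) = M.d tot ν
  rw [hmean, ← hd, Matrix.mulVec_smul, Matrix.mulVec_smul, hLy]

variable {φ : ℝ → EReal} {n : Fin k → ℕ} {p : Fin k → ℝ}

theorem phiDivergence_mean (hφ : IsDivergenceGenerator φ) (hN : 0 < N) (hp : ∀ i, 0 < p i)
    (hn : ∀ i, (n i : ℝ) = N * p i) (θ : Fin M.t → ℝ) :
    phiDivergence φ (fun i => (n i : ℝ)) (M.mean θ) =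
      ((N * realDivergence φ p (N⁻¹ • M.mean θ) : ℝ) : EReal) := by
  have h1 : (fun i => (n i : ℝ)) = N • p := funext hn
  have h2 : M.mean θ = N • (N⁻¹ • M.mean θ) := by
    rw [smul_smul, mul_inv_cancel₀ hN.ne', one_smul]
  rw [h1, hφ.phiDivergence_eq (a := N • p) (fun i => mul_pos hN (hp i)) (M.mean_pos θ), EReal.coe_eq_coe_iff]
  conv_lhs => rw [h2]
  exact realDivergence_smul φ hN.ne' _ _

theorem isDivergenceMinimizer_of_isMinimizer (hφ : IsDivergenceGenerator φ) (hN : 0 < N)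
    (hm : ∀ i, 0 < m i) (hnull : N • m ∈ M.model X₀ tot ν) (hp : ∀ i, 0 < p i)
    (hn : ∀ i, (n i : ℝ) = N * p i) {θ : Fin M.t → ℝ} (hθ : M.IsMinimizer X₀ tot ν φ n θ) :
    IsDivergenceMinimizer φ p (feasibleSet m M.colSpace (M.L X₀)) (N⁻¹ • M.mean θ) := by
  refine ⟨smul_mean_mem_feasibleSet hN hm hnull hθ.1, fun y hy => ?_⟩
  obtain ⟨θ', hθ', hmean⟩ := exists_mean_eq_smul hm hnull hy
  have h := hθ.2 θ' hθ'
  rw [phiDivergence_mean hφ hN hp hn, phiDivergence_mean hφ hN hp hn, hmean, smul_smul,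
    inv_mul_cancel₀ hN.ne', one_smul, EReal.coe_le_coe_iff] at h
  exact le_of_mul_le_mul_left h hN

theorem exists_isMinimizer (hφ : IsDivergenceGenerator φ) (hN : 0 < N)
    (hm : ∀ i, 0 < m i) (hnull : N • m ∈ M.model X₀ tot ν) (hp : ∀ i, 0 < p i)
    (hn : ∀ i, (n i : ℝ) = N * p i) {x : Fin k → ℝ}
    (hx : IsDivergenceMinimizer φ p (feasibleSet m M.colSpace (M.L X₀)) x) :
    ∃ θ, M.IsMinimizer X₀ tot ν φ n θ := by
  obtain ⟨θ, hθ, hmean⟩ := exists_mean_eq_smul hm hnull hx.1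
  refine ⟨θ, hθ, fun θ' hθ' => ?_⟩
  rw [phiDivergence_mean hφ hN hp hn, phiDivergence_mean hφ hN hp hn, hmean, smul_smul,
    inv_mul_cancel₀ hN.ne', one_smul, EReal.coe_le_coe_iff]
  exact mul_le_mul_of_nonneg_left (hx.2 _ (smul_mean_mem_feasibleSet hN hm hnull hθ')) hN.le

theorem testStat_eq {M M' : LMLC k} (hφ : IsDivergenceGenerator φ) (hN : 0 < N)
    (θ' : Fin M'.t → ℝ) (θ : Fin M.t → ℝ) :
    M'.testStat M φ θ' θ = N * (2 / secondDerivOne φ *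
      realDivergence φ (N⁻¹ • M.mean θ) (N⁻¹ • M'.mean θ')) := by
  rw [testStat, hφ.phiDivergence_eq (M.mean_pos θ) (M'.mean_pos θ'), EReal.toReal_coe]
  rw [realDivergence_smul φ (inv_ne_zero hN.ne')]
  field_simp

/-- The tangent space of the model at `m`, in standardized coordinates. -/
def tangent (M : LMLC k) (X₀ : Matrix (Fin k) (Fin c) ℝ) (m : Fin k → ℝ) :
    Submodule ℝ (EuclideanSpace ℝ (Fin k)) :=
  tangentSpaceAt m M.colSpace (M.L X₀)

/-- The constraints are regular at `m`. -/
def IsRegularAt (M : LMLC k) (X₀ : Matrix (Fin k) (Fin c) ℝ) (m : Fin k → ℝ) : Prop :=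
  Function.Surjective (logConstraintMap m M.colSpace (M.L X₀))

/-- The columns of `X₀` are among those of `L`. This is why the degeneracy of the limit law under
prefixed totals does not affect the statistics. -/
theorem tangent_le_ker (M : LMLC k) (X₀ : Matrix (Fin k) (Fin c) ℝ) (m : Fin k → ℝ) :
    M.tangent X₀ m ≤ LinearMap.ker (constraintMap m X₀) := by
  intro w hw
  have h := hw.2
  rw [SetLike.mem_coe, LinearMap.mem_ker, constraintMap_apply] at h
  rw [LinearMap.mem_ker, constraintMap_apply]
  funext j
  exact congrFun h (Sum.inl j)

theorem NestedIn.tangent_le {M' M : LMLC k} {tot : ℕ → Fin c → ℕ} (h : M'.NestedIn M X₀ tot)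
    (m : Fin k → ℝ) : M'.tangent X₀ m ≤ M.tangent X₀ m :=
  tangentSpaceAt_mono h.span_X_le h.span_L_le

theorem NestedIn.isRegularAt {M' M : LMLC k} {tot : ℕ → Fin c → ℕ} (h : M'.NestedIn M X₀ tot)
    (hM : M.IsAdmissible X₀) (hreg : M'.IsRegularAt X₀ m) : M.IsRegularAt X₀ m :=
  surjective_logConstraintMap_mono h.span_X_le h.span_L_le
    (by rw [hM.rank_L, Fintype.card_sum, Fintype.card_fin, Fintype.card_fin]) hreg

/-- The test statistics are approximated by squared lengths of differences of projections of the
standardized table. -/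
theorem eventually_abs_testStat_sub_le {M M' : LMLC k} {φ₁ φ₂ : ℝ → EReal}
    (hφ₁ : IsDivergenceGenerator φ₁) (hφ₂ : IsDivergenceGenerator φ₂)
    {N : ℕ → ℝ} (hN : Tendsto N atTop atTop) (hNpos : ∀ ν, 0 < N ν) (hm : ∀ i, 0 < m i)
    {tot : ℕ → Fin c → ℕ} (hnull : ∀ ν, N ν • m ∈ M.model X₀ (tot ν) ν)
    (hnull' : ∀ ν, N ν • m ∈ M'.model X₀ (tot ν) ν)
    (hreg : M.IsRegularAt X₀ m) (hreg' : M'.IsRegularAt X₀ m)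
    {est : ℕ → (Fin k → ℕ) → Fin M.t → ℝ} {est' : ℕ → (Fin k → ℕ) → Fin M'.t → ℝ}
    (hest : ∀ ν, M.IsMinDivEstimator X₀ (tot ν) ν φ₂ (est ν))
    (hest' : ∀ ν, M'.IsMinDivEstimator X₀ (tot ν) ν φ₂ (est' ν)) {ε : ℝ} (hε : 0 < ε) (K : ℝ) :
    ∀ᶠ ν in atTop, ∀ n : Fin k → ℕ, ‖standardize (N ν • m) fun i => (n i : ℝ)‖ ≤ K →
      |M'.testStat M φ₁ (est' ν n) (est ν n) -
        ‖((M.tangent X₀ m).starProjection - (M'.tangent X₀ m).starProjection)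
          (standardize (N ν • m) fun i => (n i : ℝ))‖ ^ 2| ≤ ε := by
  have hpos : ∀ᶠ p in 𝓝 m, ∀ i, 0 < p i :=
    eventually_all.2 fun i => ((continuous_apply i).tendsto m).eventually_const_lt (hm i)
  -- After multiplication by `N` the error is at most `ε / (K ^ 2 + 1)` times `N ‖standardize m p‖ ^
  -- 2 ≤ K ^ 2`; the added 1 keeps the denominator positive.
  have hnear := ((eventually_abs_divergence_sub_le hφ₁ hφ₂ hm hreg hreg'
    (ε := ε / (K ^ 2 + 1)) (by positivity)).and
    (eventually_exists_isDivergenceMinimizer (V := M.colSpace) (L := M.L X₀) hφ₂ hm)).and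
    ((eventually_exists_isDivergenceMinimizer (V := M'.colSpace) (L := M'.L X₀) hφ₂ hm).and hpos)
  obtain ⟨δ, hδ, hball⟩ := Metric.eventually_nhds_iff_ball.1 hnear
  have hlocal : ∀ᶠ ν in atTop, ∀ p : Fin k → ℝ, √(N ν) * ‖standardize m p‖ ≤ K →
      p ∈ Metric.ball m δ := by
    have hδK : ∀ᶠ ν in atTop, ∀ i, √(m i) * (K / √(N ν)) < δ := by
      refine eventually_all.2 fun i => ?_
      have h1 : Tendsto (fun ν => √(m i) * (K / √(N ν))) atTop (𝓝 0) := by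
        simpa using ((Real.tendsto_sqrt_atTop.comp hN).const_div_atTop K).const_mul (√(m i))
      exact h1.eventually_lt_const hδ
    filter_upwards [hδK] with ν hν p hp
    rw [Metric.mem_ball, dist_pi_lt_iff hδ]
    intro i
    have h2 := Real.sqrt_pos.2 (hNpos ν)
    have h3 := Real.sqrt_pos.2 (hm i)
    refine lt_of_le_of_lt ?_ (hν i)
    have h4 : ‖standardize m p i‖ ≤ K / √(N ν) := by
      rw [le_div_iff₀' h2]
      exact (mul_le_mul_of_nonneg_left (PiLp.norm_apply_le _ i) h2.le).trans hp
    have h5 : |p i - m i| = √(m i) * ‖standardize m p i‖ := by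
      rw [standardize, Real.norm_eq_abs, abs_div, abs_of_pos h3, mul_div_cancel₀ _ h3.ne']
    rw [Real.dist_eq, h5]
    gcongr
  filter_upwards [hlocal] with ν hν n hn
  set p : Fin k → ℝ := (N ν)⁻¹ • fun i => (n i : ℝ)
  have hNp : (fun i => (n i : ℝ)) = N ν • p := by
    rw [smul_smul, mul_inv_cancel₀ (hNpos ν).ne', one_smul]
  have hnp : ∀ i, (n i : ℝ) = N ν * p i := fun i => congrFun hNp i
  have hsqrt := Real.sqrt_pos.2 (hNpos ν)
  rw [hNp, standardize_smul (hNpos ν)] at hn ⊢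
  rw [norm_smul, Real.norm_of_nonneg hsqrt.le] at hn
  obtain ⟨⟨happ, x, hx⟩, ⟨x', hx'⟩, hp⟩ := hball p (hν p hn)
  -- For such tables a minimizer exists, so the estimator is not at one of its arbitrary values.
  have hmin := hest ν n (exists_isMinimizer hφ₂ (hNpos ν) hm (hnull ν) hp hnp hx)
  have hmin' := hest' ν n (exists_isMinimizer hφ₂ (hNpos ν) hm (hnull' ν) hp hnp hx')
  have h1 := happ _ _
    (isDivergenceMinimizer_of_isMinimizer hφ₂ (hNpos ν) hm (hnull ν) hp hnp hmin)
    (isDivergenceMinimizer_of_isMinimizer hφ₂ (hNpos ν) hm (hnull' ν) hp hnp hmin')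
  rw [testStat_eq hφ₁ (hNpos ν), map_smul, norm_smul, mul_pow, Real.norm_of_nonneg hsqrt.le,
    Real.sq_sqrt (hNpos ν).le, ← mul_sub, abs_mul, abs_of_pos (hNpos ν)]
  have h2 := mul_le_mul_of_nonneg_left h1 (hNpos ν).le
  refine h2.trans ?_
  have h3 : N ν * ‖standardize m p‖ ^ 2 ≤ K ^ 2 := by
    rw [← Real.sq_sqrt (hNpos ν).le, ← mul_pow]
    exact pow_le_pow_left₀ (by positivity) hn 2
  rw [mul_left_comm, div_mul_eq_mul_div, div_le_iff₀ (by positivity)]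
  nlinarith

/-- Asymptotic independence of the two test statistics for three nested models. -/
theorem asymptoticallyIndependent_testStat {M₁ M₂ M₃ : LMLC k} (hX₀ : IsSamplingMatrix X₀)
    {φ₁ φ₂ : ℝ → EReal} (hφ₁ : IsDivergenceGenerator φ₁) (hφ₂ : IsDivergenceGenerator φ₂)
    {tot : ℕ → Fin c → ℕ} (h₁ : M₁.IsAdmissible X₀) (h₂ : M₂.IsAdmissible X₀)
    (h₂₁ : M₂.NestedIn M₁ X₀ tot) (h₃₂ : M₃.NestedIn M₂ X₀ tot)
    {N : ℕ → ℝ} (hN : Tendsto N atTop atTop) (hNpos : ∀ ν, 0 < N ν) (hm : ∀ i, 0 < m i)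
    (hnull : ∀ ν, N ν • m ∈ M₃.model X₀ (tot ν) ν) (hreg : M₃.IsRegularAt X₀ m)
    {Ω : ℕ → Type*} [∀ ν, MeasurableSpace (Ω ν)] (P : ∀ ν, Measure (Ω ν))
    [∀ ν, IsProbabilityMeasure (P ν)] (n : ∀ ν, Ω ν → Fin k → ℕ)
    (hn : ∀ ν, HasLaw (n ν) (samplingLaw X₀ (tot ν) (N ν • m)) (P ν))
    {est₁ : ℕ → (Fin k → ℕ) → Fin M₁.t → ℝ} {est₂ : ℕ → (Fin k → ℕ) → Fin M₂.t → ℝ}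
    {est₃ : ℕ → (Fin k → ℕ) → Fin M₃.t → ℝ}
    (hest₁ : ∀ ν, M₁.IsMinDivEstimator X₀ (tot ν) ν φ₂ (est₁ ν))
    (hest₂ : ∀ ν, M₂.IsMinDivEstimator X₀ (tot ν) ν φ₂ (est₂ ν))
    (hest₃ : ∀ ν, M₃.IsMinDivEstimator X₀ (tot ν) ν φ₂ (est₃ ν)) :
    AsymptoticallyIndependent P
      (fun ν ω => M₃.testStat M₂ φ₁ (est₃ ν (n ν ω)) (est₂ ν (n ν ω)))
      (fun ν ω => M₂.testStat M₁ φ₁ (est₂ ν (n ν ω)) (est₁ ν (n ν ω))) := by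
  have hnull₂ : ∀ ν, N ν • m ∈ M₂.model X₀ (tot ν) ν := fun ν => h₃₂.model_subset ν (hnull ν)
  have hnull₁ : ∀ ν, N ν • m ∈ M₁.model X₀ (tot ν) ν := fun ν => h₂₁.model_subset ν (hnull₂ ν)
  have hreg₂ := h₃₂.isRegularAt h₂ hreg
  have hreg₁ := h₂₁.isRegularAt h₁ hreg₂
  have hproj : ∀ (M : LMLC k) (x : EuclideanSpace ℝ (Fin k)),
      (M.tangent X₀ m).starProjection
        ((LinearMap.ker (constraintMap m X₀)).starProjection x) =
      (M.tangent X₀ m).starProjection x := fun M x =>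
    starProjection_starProjection_of_le (M.tangent_le_ker X₀ m) x
  refine asymptoticallyIndependent_of_approx (m := m)
    (A := (M₂.tangent X₀ m).starProjection - (M₃.tangent X₀ m).starProjection)
    (B := (M₁.tangent X₀ m).starProjection - (M₂.tangent X₀ m).starProjection)
    (S := fun ν n => M₃.testStat M₂ φ₁ (est₃ ν n) (est₂ ν n))
    (T := fun ν n => M₂.testStat M₁ φ₁ (est₂ ν n) (est₁ ν n))
    hX₀ hN hNpos hm (fun ν => transpose_mulVec_eq_tot (hnull ν))
    (isSymmetric_starProjection_sub _ _) (isSymmetric_starProjection_sub _ _)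
    (starProjection_sub_comp_eq_zero (h₃₂.tangent_le m) (h₂₁.tangent_le m))
    (fun x => ?_) (fun x => ?_) (fun ε hε K => ?_) (fun ε hε K => ?_) P n hn
  · simp only [_root_.sub_apply, hproj]
  · simp only [_root_.sub_apply, hproj]
  · exact eventually_abs_testStat_sub_le hφ₁ hφ₂ hN hNpos hm hnull₂ hnull hreg₂ hreg hest₂ hest₃
      hε K
  · exact eventually_abs_testStat_sub_le hφ₁ hφ₂ hN hNpos hm hnull₁ hnull₂ hreg₁ hreg₂ hest₁
      hest₂ hε K

end LMLC
end

/-! ### The theorem for a sequence of models -/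

theorem theorem10
    {k c : ℕ} (X₀ : Matrix (Fin k) (Fin c) ℝ) (hX₀ : IsSamplingMatrix X₀)
    (φ₁ φ₂ : ℝ → EReal) (hφ₁ : IsDivergenceGenerator φ₁) (hφ₂ : IsDivergenceGenerator φ₂)
    -- the prefixed totals of the subtables (none if `c = 0`)
    (tot : ℕ → Fin c → ℕ)
    -- a nested sequence `M 1, …, M B` of models, and three consecutive ones `b - 1`, `b`, `b + 1`
    (M : ℕ → LMLC k) (B b : ℕ) (hb : 2 ≤ b) (hbB : b + 1 ≤ B)
    (hM : ∀ j, 1 ≤ j → j ≤ B → (M j).IsAdmissible X₀)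
    (hnest : ∀ j, 1 ≤ j → j < B → (M (j + 1)).NestedIn (M j) X₀ tot)
    -- `N → ∞` with a fixed normalized mean vector `mstar`; the true mean `N mstar` is in `M (b + 1)`
    (N : ℕ → ℝ) (hN : Tendsto N atTop atTop) (mstar : Fin k → ℝ) (hmstar : ∑ i, mstar i = 1)
    (hnull : ∀ ν, N ν • mstar ∈ (M (b + 1)).model X₀ (tot ν) ν)
    -- the constraints are regular at the truth
    (hreg : ((M (b + 1)).Xᵀ * Matrix.diagonal mstar * (M (b + 1)).L X₀).rank = c + (M (b + 1)).r)
    -- the data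
    {Ω : ℕ → Type*} [∀ ν, MeasurableSpace (Ω ν)] (P : ∀ ν, Measure (Ω ν))
    [∀ ν, IsProbabilityMeasure (P ν)] (n : ∀ ν, Ω ν → Fin k → ℕ)
    (hn : ∀ ν, HasLaw (n ν) (samplingLaw X₀ (tot ν) (N ν • mstar)) (P ν))
    -- the minimum `φ₂`-divergence estimators
    (est : ∀ (_ν : ℕ) (j : ℕ), (Fin k → ℕ) → Fin (M j).t → ℝ)
    (hest : ∀ ν j, 1 ≤ j → j ≤ B → (M j).IsMinDivEstimator X₀ (tot ν) ν φ₂ (est ν j)) :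
    AsymptoticallyIndependent P
      (fun ν ω => (M (b + 1)).testStat (M b) φ₁ (est ν (b + 1) (n ν ω)) (est ν b (n ν ω)))
      (fun ν ω => (M b).testStat (M (b - 1)) φ₁ (est ν b (n ν ω)) (est ν (b - 1) (n ν ω))) := by
  -- Writing `b` as a successor removes the truncated subtraction in `b - 1`; `2 ≤ b` keeps the new
  -- index at least 1.
  obtain ⟨b, rfl⟩ : ∃ b', b = b' + 1 := ⟨b - 1, by omega⟩
  have hmul : ∀ ν i, 0 < N ν * mstar i := by
    intro ν i
    obtain ⟨θ, -, h⟩ := hnull ν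
    have h1 : 0 < (N ν • mstar) i := h ▸ LMLC.mean_pos _ θ i
    exact h1
  -- Means are exponentials, so every `N ν * mstar i` is positive. Summing over the cells gives `N
  -- ν`, as `mstar` sums to 1, which also excludes an empty table.
  have hNpos : ∀ ν, 0 < N ν := by
    intro ν
    have hne : (Finset.univ : Finset (Fin k)).Nonempty := by
      by_contra h
      rw [Finset.not_nonempty_iff_eq_empty] at h
      simp [h] at hmstar
    have h := Finset.sum_pos (fun i _ => hmul ν i) hne
    rwa [← Finset.mul_sum, hmstar, mul_one] at h
  have hm : ∀ i, 0 < mstar i := fun i => (mul_pos_iff_of_pos_left (hNpos 0)).1 (hmul 0 i)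
  have hreg' : (M (b + 1 + 1)).IsRegularAt X₀ mstar :=
    surjective_logConstraintMap_of_rank
      (by rw [hreg, Fintype.card_sum, Fintype.card_fin, Fintype.card_fin])
  exact LMLC.asymptoticallyIndependent_testStat (M₁ := M b) (M₂ := M (b + 1))
    (M₃ := M (b + 1 + 1)) hX₀ hφ₁ hφ₂ (hM b (by omega) (by omega))
    (hM (b + 1) (by omega) (by omega)) (hnest b (by omega) (by omega))
    (hnest (b + 1) (by omega) (by omega)) hN hNpos hm hnull hreg' P n hn
    (est₁ := fun ν => est ν b) (est₂ := fun ν => est ν (b + 1))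
    (est₃ := fun ν => est ν (b + 1 + 1)) (fun ν => hest ν b (by omega) (by omega))
    (fun ν => hest ν (b + 1) (by omega) (by omega))
    (fun ν => hest ν (b + 1 + 1) (by omega) (by omega))
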